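/- Conventions. A $C^*$-correspondence $(X,\varphi)$ from a $C^*$-algebra $A$ to a $C^*$-algebra $B$ is a right Hilbert $B$-module $X$ with a (possibly degenerate) $*$-homomorphism $\varphi\colon A\to\mathcal L(X)$ into the adjointable operators; it is injective if $\varphi$ is, and full if the inner products span a dense subspace of $B$. $\mathcal K(X)$ is the closed linear span of the operators $\Theta_{\xi,\eta}\colon\zeta\mapsto\xi\langle\eta,\zeta\rangle$. If $A=B$, put $J_X=(\ker\varphi)^{\perp}\cap\varphi^{-1}(\mathcal K(X))$, where $I^\perp=\{a : ab=0 \text{ for all } b\in I\}$. A representation of $(X,A,\varphi)$ in a $C^*$-algebra $C$ is a pair of a $*$-homomorphism $\pi\colon A\to C$ and a linear map $t\colon X\to C$ with $\pi(a)t(\xi)=t(\varphi(a)\xi)$ and $t(\xi)^*t(\eta)=\pi(\langle\xi,\eta\rangle)$; it is covariant if $\psi_t(\varphi(a))=\pi(a)$ for all $a\in J_X$, where $\psi_t\colon\mathcal K(X)\to C$ is the continuous linear map with $\psi_t(\Theta_{\xi,\eta})=t(\xi)t(\eta)^*$. Data. Let $\mathcal G$ be a connected directed graph with vertex set $\mathcal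 G^{(0)}$, edge set $\mathcal G^{(1)}$, range and source maps $r,s$, in which every vertex receives an edge, and let $p_0$ be a vertex at which no edge starts. Assume that $\mathcal G$ is contractible at $p_0$: in the universal $C^*$-algebra $\mathcal O_{\mathcal G}$ of Cuntz–Krieger families of $\mathcal G$ (projections $L_p$ and partial isometries $L_e$ with $L_pL_q=0$ for $p\ne q$, $L_e^*L_f=0$ for $e\neq f$, $L_e^*L_e=L_{s(e)}$, $L_eL_e^*\le L_{r(e)}$, and $\sum_{r(e)=p}L_eL_e^*=L_p$ whenever $0<|r^{-1}(p)|<\infty$) the subalgebra $\mathbb C L_{p_0}$ is a full corner. Let $e_1e_2e_3\dots$ be the infinite path ending at $p_0$, that is $r(e_1)=p_0$ and $s(e_n)=r(e_{n+1})$. Let $(A_p)_{p\in\mathcal G^{(0)}}$ be $C^*$-algebras and put $A=A_{p_0}$. For each edge $e$ let $(X_e,\varphi_e)$ be a full $C^*$-correspondence from $A_{r(e)}$ to $A_{s(e)}$, such that for $e\ne e_1$ the map $\varphi_e$ is injective with $\varphi_e(A_{r(e)})=\mathcal K(X_e)$, and such that $\mathcal K(X_{e_1})\subseteq\varphi_{e_1}(A)$.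 Write $(X_1,\varphi_1)=(X_{e_1},\varphi_{e_1})$. Let $(X,A,\varphi_X)$ be a non-injective $C^*$-correspondence over $A$. Put $A_\tau=A\oplus T_0$, where $T_0$ is the $c_0$-sum of the $A_p$, $p\ne p_0$, and $X_\tau=X\oplus T_1$, where $T_1$ is the right Hilbert $T_0$-module obtained by completing the finitely supported families $u=(u_e)_{e}$, $u_e\in X_e$, for the inner product $\langle u,v\rangle(p)=\sum_{s(e)=p}\langle u_e,v_e\rangle$, with right action $(ux)_e=u_ex_{s(e)}$. Let $A_\tau$ act on the left of $X_\tau$ by $\varphi_\tau(a,x)(\xi,u)=(\varphi_X(a)\xi,v)$ with $v_{e_1}=\varphi_1(a)u_{e_1}$ and $v_e=\varphi_e(x_{r(e)})u_e$ for $e\neq e_1$. Proposition. Suppose that $\varphi_\tau$ is injective, that $$\big(\varphi_1^{-1}(\mathcal K(X_1))+J_X\big)\oplus 0\subseteq J_{X_\tau},$$ and that for every covariant representation $(\pi,t)$ of $(X_\tau,A_\tau,\varphi_\tau)$ the restriction $(\pi|_A,t|_X)$ is a covariant representation of $(X,A,\varphi_X)$. Then $$J_X\subseteq\ker\varphi_1\subseteq(\ker\varphi_X)^\perp\qquad\text{and}\qquad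 \varphi_1^{-1}(\mathcal K(X_1))\subseteq\varphi_X^{-1}(\mathcal K(X)).$$ -/

import Mathlib

open Filter Topology Set
open scoped ENNReal ComplexOrder Pointwise

universe u

noncomputable section

namespace CStarTail

/-! ### Right Hilbert modules

Mathlib's `CStarModule D E` has an inner product that is linear in the second variable and satisfies
`⟪x, d • y⟫ = d * ⟪x, y⟫`. For `D = Bᵐᵒᵖ` these are exactly the axioms of a right Hilbert `B`-module:
`op b • x` is `x b`, and the inner product, read in `B`, satisfies `⟨x, y b⟩ = ⟨x, y⟩ b`. -/

section RightInner

/-- The `B`-valued inner product of a right Hilbert `B`-module. -/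
def rinner (B : Type*) {E : Type*} [NonUnitalCStarAlgebra B] [PartialOrder B]
    [NormedAddCommGroup E] [NormedSpace ℂ E] [SMul Bᵐᵒᵖ E] [CStarModule Bᵐᵒᵖ E] (x y : E) : B :=
  (inner Bᵐᵒᵖ x y).unop

variable {B E : Type*} [NonUnitalCStarAlgebra B] [PartialOrder B]
  [NormedAddCommGroup E] [NormedSpace ℂ E] [SMul Bᵐᵒᵖ E] [CStarModule Bᵐᵒᵖ E]

theorem rinner_add_right (x y z : E) : rinner B x (y + z) = rinner B x y + rinner B x z := by
  simp [rinner]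

theorem rinner_add_left (x y z : E) : rinner B (x + y) z = rinner B x z + rinner B y z := by
  simp [rinner]

theorem rinner_sub_right (x y z : E) : rinner B x (y - z) = rinner B x y - rinner B x z := by
  simp [rinner]

theorem rinner_sub_left (x y z : E) : rinner B (x - y) z = rinner B x z - rinner B y z := by
  simp [rinner]

theorem rinner_smul_right (c : ℂ) (x y : E) : rinner B x (c • y) = c • rinner B x y := by
  simp [rinner]

theorem rinner_smul_left (c : ℂ) (x y : E) : rinner B (c • x) y = star c • rinner B x y := by
  simp [rinner]

theorem rinner_op_smul_right (b : B) (x y : E) :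
    rinner B x (MulOpposite.op b • y) = rinner B x y * b := by
  simp [rinner]

theorem rinner_op_smul_left (b : B) (x y : E) :
    rinner B (MulOpposite.op b • x) y = star b * rinner B x y := by
  simp [rinner]

theorem star_rinner (x y : E) : star (rinner B x y) = rinner B y x := by
  rw [rinner, rinner, ← MulOpposite.unop_star, CStarModule.star_inner]

theorem rinner_self_nonneg (x : E) : 0 ≤ rinner B x x :=
  MulOpposite.unop_nonneg.2 (CStarModule.inner_self_nonneg (A := Bᵐᵒᵖ))

theorem rinner_self_eq_zero {x : E} : rinner B x x = 0 ↔ x = 0 := by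
  rw [rinner, MulOpposite.unop_eq_zero_iff, CStarModule.inner_self]

theorem norm_sq_eq_rinner (x : E) : ‖x‖ ^ 2 = ‖rinner B x x‖ := by
  rw [CStarModule.norm_sq_eq Bᵐᵒᵖ, rinner, MulOpposite.norm_unop]

theorem norm_rinner_le [StarOrderedRing B] (x y : E) : ‖rinner B x y‖ ≤ ‖x‖ * ‖y‖ := by
  rw [rinner, MulOpposite.norm_unop]
  exact CStarModule.norm_inner_le (A := Bᵐᵒᵖ) E

theorem rinner_ext {x y : E} (h : ∀ z, rinner B z x = rinner B z y) : x = y := by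
  rw [← sub_eq_zero, ← rinner_self_eq_zero (B := B), rinner_sub_right, h, sub_self]

theorem norm_op_smul_le (b : B) (x : E) : ‖MulOpposite.op b • x‖ ≤ ‖x‖ * ‖b‖ := by
  refine abs_le_of_sq_le_sq' ?_ (by positivity) |>.2
  rw [norm_sq_eq_rinner (B := B), rinner_op_smul_right, rinner_op_smul_left, mul_pow,
    norm_sq_eq_rinner (B := B) x]
  calc ‖star b * rinner B x x * b‖ ≤ ‖star b‖ * ‖rinner B x x‖ * ‖b‖ :=
        (norm_mul_le _ _).trans (by gcongr; exact norm_mul_le _ _)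
    _ = ‖rinner B x x‖ * ‖b‖ ^ 2 := by rw [norm_star]; ring

theorem add_op_smul (b c : B) (x : E) :
    MulOpposite.op (b + c) • x = MulOpposite.op b • x + MulOpposite.op c • x :=
  rinner_ext (B := B) fun z => by
    simp only [rinner_op_smul_right, rinner_add_right, mul_add]

theorem smul_op_smul (k : ℂ) (b : B) (x : E) :
    MulOpposite.op (k • b) • x = k • (MulOpposite.op b • x) :=
  rinner_ext (B := B) fun z => by
    simp only [rinner_op_smul_right, rinner_smul_right, mul_smul_comm]

theorem op_smul_add (b : B) (x y : E) :
    MulOpposite.op b • (x + y) = MulOpposite.op b • x + MulOpposite.op b • y :=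
  rinner_ext (B := B) fun z => by
    simp only [rinner_op_smul_right, rinner_add_right, add_mul]

theorem op_smul_smul (k : ℂ) (b : B) (x : E) :
    MulOpposite.op b • (k • x) = k • (MulOpposite.op b • x) :=
  rinner_ext (B := B) fun z => by
    simp only [rinner_op_smul_right, rinner_smul_right, smul_mul_assoc]

/-- The rank-one operator `Θ_{ξ,η} : ζ ↦ ξ ⟨η, ζ⟩`. -/
def rankOne (B : Type*) {E : Type*} [NonUnitalCStarAlgebra B] [PartialOrder B] [StarOrderedRing B]
    [NormedAddCommGroup E] [NormedSpace ℂ E] [SMul Bᵐᵒᵖ E] [CStarModule Bᵐᵒᵖ E] (ξ η : E) :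
    E →L[ℂ] E :=
  LinearMap.mkContinuous
    { toFun := fun ζ => MulOpposite.op (rinner B η ζ) • ξ
      map_add' := fun x y => by rw [rinner_add_right, add_op_smul]
      map_smul' := fun k x => by rw [rinner_smul_right, smul_op_smul, RingHom.id_apply] }
    (‖ξ‖ * ‖η‖) fun ζ => (norm_op_smul_le (rinner B η ζ) ξ).trans (by
      rw [mul_assoc]; gcongr; exact norm_rinner_le η ζ)

/-- `K(E)`: the operator-norm closure of the span of the rank-one operators. -/
def compactOps (B E : Type*) [NonUnitalCStarAlgebra B] [PartialOrder B] [StarOrderedRing B]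
    [NormedAddCommGroup E] [NormedSpace ℂ E] [SMul Bᵐᵒᵖ E] [CStarModule Bᵐᵒᵖ E] :
    Submodule ℂ (E →L[ℂ] E) :=
  (Submodule.span ℂ {T | ∃ ξ η : E, T = rankOne B ξ η}).topologicalClosure

theorem rankOne_mem_compactOps [StarOrderedRing B] (ξ η : E) :
    rankOne B ξ η ∈ compactOps B E :=
  Submodule.le_topologicalClosure _ (Submodule.subset_span ⟨ξ, η, rfl⟩)

end RightInner

/-! ### C⋆-correspondences and their representations -/

/-- A C⋆-correspondence from `A` to `B`: a right Hilbert `B`-module `X` (complete) with a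
`*`-homomorphism `φ` from `A` to the adjointable operators on `X`. That `φ` takes adjointable values
and preserves the involution is the field `φ_adjoint`: `φ (star a)` is the adjoint of `φ a`. -/
structure Corr (A B : Type u) [NonUnitalCStarAlgebra A]
    [NonUnitalCStarAlgebra B] [PartialOrder B] [StarOrderedRing B] : Type (u + 1) where
  carrier : Type u
  [normedGroup : NormedAddCommGroup carrier]
  [normedSpace : NormedSpace ℂ carrier]
  [complete : CompleteSpace carrier]
  [rightAction : SMul Bᵐᵒᵖ carrier]
  [hilbert : CStarModule Bᵐᵒᵖ carrier]
  φ : A →ₙₐ[ℂ] (carrier →L[ℂ] carrier)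
  φ_adjoint : ∀ a x y, rinner B (φ a x) y = rinner B x (φ (star a) y)

attribute [instance] Corr.normedGroup Corr.normedSpace Corr.complete Corr.rightAction Corr.hilbert

namespace Corr

instance (A B : Type u) [NonUnitalCStarAlgebra A] [NonUnitalCStarAlgebra B] [PartialOrder B]
    [StarOrderedRing B] : CoeSort (Corr A B) (Type u) := ⟨Corr.carrier⟩

section

variable {A B : Type u} [NonUnitalCStarAlgebra A]
  [NonUnitalCStarAlgebra B] [PartialOrder B] [StarOrderedRing B]

/-- `ker φ`. -/
def ker (X : Corr A B) : Set A := {a | X.φ a = 0}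

/-- `φ⁻¹(K(X))`. -/
def preK (X : Corr A B) : Set A := {a | X.φ a ∈ compactOps B X}

/-- `X` is injective when its left action is. -/
def IsInjective (X : Corr A B) : Prop := Function.Injective X.φ

/-- `X` is full: the inner products span a dense subspace of `B`. -/
def IsFull (X : Corr A B) : Prop :=
  (Submodule.span ℂ {b : B | ∃ x y : X, b = rinner B x y}).topologicalClosure = ⊤

end

end Corr

/-- `I^⊥ = {a | a b = 0 for all b ∈ I}`. -/
def perp {A : Type u} [NonUnitalCStarAlgebra A] (I : Set A) : Set A := {a | ∀ b ∈ I, a * b = 0}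

section ToeplitzRep

variable {A : Type u} [NonUnitalCStarAlgebra A] [PartialOrder A] [StarOrderedRing A]

/-- `J_X = (ker φ_X)^⊥ ∩ φ_X⁻¹(K(X))`. -/
def Corr.J (X : Corr A A) : Set A := perp X.ker ∩ X.preK

/-- A (Toeplitz) representation of `X` in the C⋆-algebra `C`. -/
structure ToeplitzRep (X : Corr A A) (C : Type u) [NonUnitalCStarAlgebra C] where
  π : A →⋆ₙₐ[ℂ] C
  t : X →ₗ[ℂ] C
  π_mul_t : ∀ a ξ, π a * t ξ = t (X.φ a ξ)
  star_t_mul_t : ∀ ξ η, star (t ξ) * t η = π (rinner A ξ η)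

/-- A representation is covariant if `ψ_t (φ_X a) = π a` for `a ∈ J_X`. Here `ψ_t : K(X) → C` is the
continuous linear map, unique since the rank-one operators span a dense subspace, with
`ψ_t Θ_{ξ,η} = t(ξ) t(η)⋆`. -/
def ToeplitzRep.IsCovariant {X : Corr A A} {C : Type u} [NonUnitalCStarAlgebra C] (R : ToeplitzRep X C) : Prop :=
  ∃ ψ : compactOps A X →L[ℂ] C,
    (∀ ξ η, ψ ⟨rankOne A ξ η, rankOne_mem_compactOps ξ η⟩ = R.t ξ * star (R.t η)) ∧
    ∀ a (ha : a ∈ X.J), ψ ⟨X.φ a, ha.2⟩ = R.π a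

end ToeplitzRep

/-! ### `c₀`-sums of C⋆-algebras -/

section C0

variable {V : Type u}

/-- The families in `ℓ^∞` whose norms vanish at infinity. -/
def c0Subalgebra (A : V → Type u) [∀ p, NonUnitalCStarAlgebra (A p)] :
    NonUnitalStarSubalgebra ℂ (lp A ∞) where
  carrier := {x | Tendsto (fun p => ‖x p‖) cofinite (𝓝 0)}
  add_mem' {x y} hx hy :=
    squeeze_zero (fun p => norm_nonneg _) (fun p => norm_add_le (x p) (y p))
      (by simpa using Tendsto.add hx hy)
  zero_mem' := by simpa using (tendsto_const_nhds : Tendsto (fun _ : V => (0 : ℝ)) cofinite (𝓝 0))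
  mul_mem' {x y} hx hy :=
    squeeze_zero (fun p => norm_nonneg _) (fun p => norm_mul_le (x p) (y p))
      (by simpa using Tendsto.mul hx hy)
  smul_mem' c x hx := by
    have h : Tendsto (fun p => ‖c‖ * ‖x p‖) cofinite (𝓝 0) := by
      simpa using Tendsto.const_mul ‖c‖ hx
    exact h.congr fun p => (norm_smul c (x p)).symm
  star_mem' {x} hx := by
    have h : Tendsto (fun p => ‖x p‖) cofinite (𝓝 0) := hx
    exact h.congr fun p => (norm_star (x p)).symm

instance isClosed_c0Subalgebra (A : V → Type u) [∀ p, NonUnitalCStarAlgebra (A p)] :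
    IsClosed (c0Subalgebra A : Set (lp A ∞)) := by
  refine isClosed_of_closure_subset fun x hx => ?_
  change Tendsto (fun p => ‖x p‖) cofinite (𝓝 0)
  rw [Metric.tendsto_nhds]
  intro ε hε
  obtain ⟨y, hy, hxy⟩ := Metric.mem_closure_iff.1 hx (ε / 2) (half_pos hε)
  have hy' : Tendsto (fun p => ‖y p‖) cofinite (𝓝 0) := hy
  filter_upwards [Metric.tendsto_nhds.1 hy' (ε / 2) (half_pos hε)] with p hp
  rw [dist_zero_right, norm_norm] at hp ⊢
  rw [dist_eq_norm] at hxy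
  have h1 : ‖x p - y p‖ ≤ ‖x - y‖ := lp.norm_apply_le_norm (by simp) (x - y) p
  have h2 : ‖x p‖ ≤ ‖x p - y p‖ + ‖y p‖ := by
    simpa using norm_add_le (x p - y p) (y p)
  linarith

/-- The `c₀`-sum of a family of C⋆-algebras: all families `(x p)` with `x p ∈ A p` and
`‖x p‖ → 0` along the cofinite filter, with the supremum norm and pointwise operations. -/
def C0Sum (A : V → Type u) [∀ p, NonUnitalCStarAlgebra (A p)] : Type u := c0Subalgebra A

variable (A : V → Type u) [∀ p, NonUnitalCStarAlgebra (A p)]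

instance : NonUnitalCStarAlgebra (C0Sum A) :=
  inferInstanceAs (NonUnitalCStarAlgebra (c0Subalgebra A))

instance : PartialOrder (C0Sum A) := CStarAlgebra.spectralOrder _

instance : StarOrderedRing (C0Sum A) := CStarAlgebra.spectralOrderedRing _

variable {A}

namespace C0Sum

/-- The component of `x` at `p`. -/
def coord (x : C0Sum A) (p : V) : A p := x.1 p

theorem ext {x y : C0Sum A} (h : ∀ p, x.coord p = y.coord p) : x = y :=
  Subtype.ext (lp.ext (funext h))

theorem coord_add (x y : C0Sum A) (p : V) : (x + y).coord p = x.coord p + y.coord p := rfl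

theorem coord_mul (x y : C0Sum A) (p : V) : (x * y).coord p = x.coord p * y.coord p := rfl

theorem coord_smul (c : ℂ) (x : C0Sum A) (p : V) : (c • x).coord p = c • x.coord p := rfl

theorem coord_zero (p : V) : (0 : C0Sum A).coord p = 0 := rfl

theorem coord_star (x : C0Sum A) (p : V) : (star x).coord p = star (x.coord p) := rfl

theorem norm_coord_le (x : C0Sum A) (p : V) : ‖x.coord p‖ ≤ ‖x‖ :=
  lp.norm_apply_le_norm (by simp) x.1 p

open Classical in
theorem single_mem (p : V) (a : A p) : lp.single ∞ p a ∈ c0Subalgebra A := by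
  change Tendsto (fun q => ‖lp.single ∞ p a q‖) cofinite (𝓝 0)
  refine tendsto_const_nhds.congr' ?_
  have : ({p}ᶜ : Set V) ∈ cofinite := (Set.finite_singleton p).compl_mem_cofinite
  filter_upwards [this] with q hq
  rw [lp.single_apply_ne _ _ _ hq, norm_zero]

open Classical in
/-- The family with `a` at `p` and `0` elsewhere. -/
def single (p : V) (a : A p) : C0Sum A := ⟨lp.single ∞ p a, single_mem p a⟩

theorem single_self (p : V) (a : A p) : (single p a).coord p = a := by
  classical
  exact lp.single_apply_self _ _ _

theorem single_ne {p q : V} (a : A p) (h : q ≠ p) : (single p a).coord q = 0 := by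
  classical
  exact lp.single_apply_ne _ _ _ h

theorem single_mul_left (p : V) (a : A p) (x : C0Sum A) :
    single p (a * x.coord p) = single p a * x := by
  refine ext fun q => ?_
  rw [coord_mul]
  rcases eq_or_ne q p with rfl | h
  · rw [single_self, single_self]
  · rw [single_ne _ h, single_ne _ h, zero_mul]

theorem single_mul_right (p : V) (a : A p) (x : C0Sum A) :
    single p (x.coord p * a) = x * single p a := by
  refine ext fun q => ?_
  rw [coord_mul]
  rcases eq_or_ne q p with rfl | h
  · rw [single_self, single_self]
  · rw [single_ne _ h, single_ne _ h, mul_zero]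

variable (A) in
/-- The inclusion of the summand `A p`, as a `*`-homomorphism. -/
def singleHom (p : V) : A p →⋆ₙₐ[ℂ] C0Sum A where
  toFun := single p
  map_smul' c a := ext fun q => by
    rw [coord_smul]
    rcases eq_or_ne q p with rfl | h
    · simp [single_self]
    · simp [single_ne _ h]
  map_zero' := ext fun q => by
    rcases eq_or_ne q p with rfl | h
    · simp [single_self, coord_zero]
    · simp [single_ne _ h, coord_zero]
  map_add' a b := ext fun q => by
    rw [coord_add]
    rcases eq_or_ne q p with rfl | h
    · simp [single_self]
    · simp [single_ne _ h]
  map_mul' a b := by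
    have := single_mul_left p a (single p b)
    rwa [single_self] at this
  map_star' a := ext fun q => by
    rcases eq_or_ne q p with rfl | h
    · rw [coord_star, single_self, single_self]
    · rw [coord_star, single_ne _ h, single_ne _ h, star_zero]

theorem singleHom_apply (p : V) (a : A p) : singleHom A p a = single p a := rfl

theorem norm_single (p : V) (a : A p) : ‖single p a‖ = ‖a‖ := by
  classical
  exact lp.norm_single (p := ∞) ENNReal.zero_lt_top p a

theorem continuous_single (p : V) : Continuous (single p : A p → C0Sum A) :=
  (AddMonoidHomClass.isometry_of_norm (singleHom A p) (norm_single p)).continuous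

theorem single_nonneg [∀ p, PartialOrder (A p)] [∀ p, StarOrderedRing (A p)] (p : V) {a : A p}
    (ha : 0 ≤ a) : 0 ≤ single p a := by
  obtain ⟨b, rfl⟩ := CStarAlgebra.nonneg_iff_eq_star_mul_self.1 ha
  rw [← singleHom_apply, map_mul, map_star]
  exact star_mul_self_nonneg _

end C0Sum

end C0

/-! ### Direct sums of correspondences along a graph -/

section Sum

/-- In a C⋆-algebra, a nonnegative family dominated by a summable family is summable. -/
theorem summable_of_le {D ι : Type*} [NonUnitalCStarAlgebra D] [PartialOrder D] [StarOrderedRing D]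
    {f g : ι → D} (hg : Summable g) (h0 : ∀ i, 0 ≤ f i) (hle : ∀ i, f i ≤ g i) : Summable f := by
  rw [summable_iff_vanishing_norm] at hg ⊢
  intro ε hε
  obtain ⟨s, hs⟩ := hg ε hε
  refine ⟨s, fun t ht => lt_of_le_of_lt ?_ (hs t ht)⟩
  exact CStarAlgebra.norm_le_norm_of_nonneg_of_le (Finset.sum_nonneg fun i _ => h0 i)
    (Finset.sum_le_sum fun i _ => hle i)

theorem rinner_add_self_le {B E : Type*} [NonUnitalCStarAlgebra B] [PartialOrder B]
    [StarOrderedRing B] [NormedAddCommGroup E] [NormedSpace ℂ E] [SMul Bᵐᵒᵖ E]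
    [CStarModule Bᵐᵒᵖ E] (x y : E) :
    rinner B (x + y) (x + y) ≤ (2 : ℝ) • rinner B x x + (2 : ℝ) • rinner B y y := by
  have h := rinner_self_nonneg (B := B) (x - y)
  rw [← sub_nonneg]
  convert h using 1
  simp only [rinner_add_right, rinner_add_left, rinner_sub_right, rinner_sub_left, two_smul]
  abel

/-- `⟨φ(a)x, φ(a)x⟩ ≤ ‖a‖² ⟨x, x⟩`. -/
theorem Corr.rinner_φ_le {A B : Type u} [NonUnitalCStarAlgebra A]
    [NonUnitalCStarAlgebra B] [PartialOrder B] [StarOrderedRing B] (X : Corr A B) (a : A) (x : X) :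
    rinner B (X.φ a x) (X.φ a x) ≤ (‖a‖ ^ 2) • rinner B x x := by
  let _ : PartialOrder A := CStarAlgebra.spectralOrder A
  have : StarOrderedRing A := CStarAlgebra.spectralOrderedRing A
  have h := CStarAlgebra.star_mul_le_algebraMap_norm_sq (a := (a : Unitization ℂ A))
  rw [Unitization.norm_inr] at h
  obtain ⟨c, hc⟩ := CStarAlgebra.nonneg_iff_eq_star_mul_self.1 (sub_nonneg.2 h)
  have key : (‖a‖ ^ 2) • rinner B x x - rinner B (X.φ a x) (X.φ a x)
      = rinner B (c.fst • x + X.φ c.snd x) (c.fst • x + X.φ c.snd x) := by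
    have e1 : rinner B (c.fst • x + X.φ c.snd x) (c.fst • x + X.φ c.snd x)
        = rinner B x ((star c * c).fst • x + X.φ (star c * c).snd x) := by
      rw [rinner_add_left, rinner_smul_left, X.φ_adjoint, ← rinner_smul_right, ← rinner_add_right]
      congr 1
      simp only [Unitization.fst_mul, Unitization.snd_mul, Unitization.fst_star,
        Unitization.snd_star, map_add, map_mul, map_smul, smul_add, mul_smul,
        add_apply, smul_apply,
        mul_apply_eq_comp]
      abel
    rw [e1, ← hc, X.φ_adjoint]
    have e2 : ((algebraMap ℝ (Unitization ℂ A)) (‖a‖ ^ 2)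
        - star (a : Unitization ℂ A) * (a : Unitization ℂ A)).fst = ((‖a‖ ^ 2 : ℝ) : ℂ) := by
      rw [sub_eq_add_neg]
      simp [Unitization.algebraMap_eq_inl_comp]
    have e3 : ((algebraMap ℝ (Unitization ℂ A)) (‖a‖ ^ 2)
        - star (a : Unitization ℂ A) * (a : Unitization ℂ A)).snd = - (star a * a) := by
      rw [sub_eq_add_neg]
      simp [Unitization.algebraMap_eq_inl_comp]
    rw [e2, e3, rinner_add_right, rinner_smul_right, map_neg, map_mul,
      neg_apply, mul_apply_eq_comp, ← neg_one_smul ℂ,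
      rinner_smul_right, neg_one_smul, ← sub_eq_add_neg]
    congr 1
  rw [← sub_nonneg, key]
  exact rinner_self_nonneg _

variable {V ι : Type u} {A : V → Type u} [∀ p, NonUnitalCStarAlgebra (A p)]
  [∀ p, PartialOrder (A p)] [∀ p, StarOrderedRing (A p)]

namespace GraphSum

variable {ρ σ : ι → V} (Y : ∀ i, Corr (A (ρ i)) (A (σ i)))

/-- The summand `⟨u_i, v_i⟩`, placed at `σ i`. -/
def term (u v : ∀ i, Y i) (i : ι) : C0Sum A := C0Sum.single (σ i) (rinner (A (σ i)) (u i) (v i))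

theorem term_self_nonneg (u : ∀ i, Y i) (i : ι) : 0 ≤ term Y u u i :=
  C0Sum.single_nonneg _ (rinner_self_nonneg _)

theorem term_add_right (u v w : ∀ i, Y i) : term Y u (v + w) = term Y u v + term Y u w := by
  funext i
  exact (congrArg (C0Sum.singleHom A (σ i)) (rinner_add_right _ _ _)).trans (map_add _ _ _)

theorem term_add_left (u v w : ∀ i, Y i) : term Y (u + v) w = term Y u w + term Y v w := by
  funext i
  exact (congrArg (C0Sum.singleHom A (σ i)) (rinner_add_left _ _ _)).trans (map_add _ _ _)

theorem term_sub_right (u v w : ∀ i, Y i) : term Y u (v - w) = term Y u v - term Y u w := by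
  funext i
  exact (congrArg (C0Sum.singleHom A (σ i)) (rinner_sub_right _ _ _)).trans (map_sub _ _ _)

theorem term_sub_left (u v w : ∀ i, Y i) : term Y (u - v) w = term Y u w - term Y v w := by
  funext i
  exact (congrArg (C0Sum.singleHom A (σ i)) (rinner_sub_left _ _ _)).trans (map_sub _ _ _)

theorem term_smul_right (c : ℂ) (u v : ∀ i, Y i) : term Y u (c • v) = c • term Y u v := by
  funext i
  exact (congrArg (C0Sum.singleHom A (σ i)) (rinner_smul_right _ _ _)).trans (map_smul _ _ _)

theorem term_smul_left (c : ℂ) (u v : ∀ i, Y i) : term Y (c • u) v = star c • term Y u v := by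
  funext i
  exact (congrArg (C0Sum.singleHom A (σ i)) (rinner_smul_left _ _ _)).trans (map_smul _ _ _)

theorem star_term (u v : ∀ i, Y i) (i : ι) : star (term Y u v i) = term Y v u i :=
  (map_star (C0Sum.singleHom A (σ i)) _).symm.trans
    (congrArg (C0Sum.singleHom A (σ i)) (star_rinner _ _))

theorem norm_term_self (u : ∀ i, Y i) (i : ι) : ‖term Y u u i‖ = ‖u i‖ ^ 2 := by
  rw [term, C0Sum.norm_single, ← norm_sq_eq_rinner]

theorem term_add_self_le (u v : ∀ i, Y i) (i : ι) :
    term Y (u + v) (u + v) i ≤ (2 : ℝ) • term Y u u i + (2 : ℝ) • term Y v v i := by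
  have h := term_self_nonneg Y (u - v) i
  rw [← sub_nonneg]
  convert h using 1
  simp only [term_add_right, term_add_left, term_sub_right, term_sub_left, two_smul,
    Pi.add_apply, Pi.sub_apply]
  abel

/-- The families `u` for which `∑ i, ⟨u_i, u_i⟩` converges in norm. -/
def squareSummable : Submodule ℂ (∀ i, Y i) where
  carrier := {u | Summable (term Y u u)}
  add_mem' {u v} hu hv :=
    summable_of_le ((Summable.const_smul (2 : ℝ) hu).add (Summable.const_smul (2 : ℝ) hv))
      (term_self_nonneg Y _) (term_add_self_le Y u v)
  zero_mem' := by
    have h : term Y 0 0 = 0 := by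
      simpa using term_smul_right Y 0 0 0
    change Summable (term Y 0 0)
    rw [h]
    exact summable_zero
  smul_mem' c u hu := by
    change Summable (term Y (c • u) (c • u))
    rw [term_smul_right, term_smul_left]
    exact Summable.const_smul c (Summable.const_smul (star c) hu)

theorem summable_term {u v : ∀ i, Y i} (hu : u ∈ squareSummable Y) (hv : v ∈ squareSummable Y) :
    Summable (term Y u v) := by
  have hI := (squareSummable Y).smul_mem Complex.I hv
  have h1 : Summable (term Y (u + v) (u + v)) := (squareSummable Y).add_mem hu hv
  have h2 : Summable (term Y (u - v) (u - v)) := (squareSummable Y).sub_mem hu hv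
  have h3 : Summable (term Y (u + Complex.I • v) (u + Complex.I • v)) :=
    (squareSummable Y).add_mem hu hI
  have h4 : Summable (term Y (u - Complex.I • v) (u - Complex.I • v)) :=
    (squareSummable Y).sub_mem hu hI
  have h := Summable.const_smul (4⁻¹ : ℂ)
    ((h1.sub h2).sub (Summable.const_smul Complex.I (h3.sub h4)))
  refine h.congr fun i => ?_
  simp only [term_add_right, term_add_left, term_sub_right, term_sub_left, term_smul_right,
    term_smul_left, Pi.add_apply, Pi.sub_apply, Pi.smul_apply, Complex.star_def, Complex.conj_I]
  match_scalars
  all_goals first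
    | ring1
    | linear_combination (1 / 2 : ℂ) * Complex.I_mul_I
    | linear_combination (-1 / 2 : ℂ) * Complex.I_mul_I

theorem op_smul_mem {u : ∀ i, Y i} (hu : u ∈ squareSummable Y) (x : C0Sum A) :
    (fun i => MulOpposite.op (x.coord (σ i)) • u i) ∈ squareSummable Y := by
  have h : Summable (term Y u u) := hu
  refine ((h.mul_left (star x)).mul_right x).congr fun i => ?_
  rw [term, term, rinner_op_smul_right, rinner_op_smul_left, C0Sum.single_mul_left,
    ← C0Sum.coord_star, C0Sum.single_mul_right]

theorem term_φ_le (a : C0Sum A) (u : ∀ i, Y i) (i : ι) :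
    term Y (fun i => (Y i).φ (a.coord (ρ i)) (u i)) (fun i => (Y i).φ (a.coord (ρ i)) (u i)) i
      ≤ (‖a‖ ^ 2) • term Y u u i := by
  have h1 := (Y i).rinner_φ_le (a.coord (ρ i)) (u i)
  have h2 : (‖a.coord (ρ i)‖ ^ 2) • rinner (A (σ i)) (u i) (u i)
      ≤ (‖a‖ ^ 2) • rinner (A (σ i)) (u i) (u i) :=
    smul_le_smul_of_nonneg_right
      (pow_le_pow_left₀ (norm_nonneg _) (C0Sum.norm_coord_le a _) 2) (rinner_self_nonneg _)
  have h3 := C0Sum.single_nonneg (A := A) (σ i) (sub_nonneg.2 (h1.trans h2))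
  rw [← C0Sum.singleHom_apply, map_sub, sub_nonneg] at h3
  refine h3.trans_eq ?_
  rw [← Complex.coe_smul, map_smul, Complex.coe_smul]
  rfl

theorem φ_mem {u : ∀ i, Y i} (hu : u ∈ squareSummable Y) (a : C0Sum A) :
    (fun i => (Y i).φ (a.coord (ρ i)) (u i)) ∈ squareSummable Y :=
  summable_of_le (Summable.const_smul (‖a‖ ^ 2) hu) (term_self_nonneg Y _) (term_φ_le Y a u)

/-- The underlying space of the direct sum. -/
def Carrier : Type u := squareSummable Y

instance : AddCommGroup (Carrier Y) := inferInstanceAs (AddCommGroup (squareSummable Y))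

instance : Module ℂ (Carrier Y) := inferInstanceAs (Module ℂ (squareSummable Y))

instance : SMul (C0Sum A)ᵐᵒᵖ (Carrier Y) :=
  ⟨fun x u => ⟨fun i => MulOpposite.op (x.unop.coord (σ i)) • u.1 i, op_smul_mem Y u.2 x.unop⟩⟩

instance : Inner (C0Sum A)ᵐᵒᵖ (Carrier Y) :=
  ⟨fun u v => MulOpposite.op (∑' i, term Y u.1 v.1 i)⟩

instance : Norm (Carrier Y) := CStarModule.norm (C0Sum A)ᵐᵒᵖ

variable {Y} in
theorem carrier_ext {u v : Carrier Y} (h : ∀ i, u.1 i = v.1 i) : u = v :=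
  Subtype.ext (funext h)

instance : CStarModule (C0Sum A)ᵐᵒᵖ (Carrier Y) where
  inner_add_right {u v w} := by
    refine MulOpposite.unop_injective ?_
    change ∑' i, term Y u.1 (v.1 + w.1) i = (∑' i, term Y u.1 v.1 i) + ∑' i, term Y u.1 w.1 i
    rw [term_add_right]
    exact (summable_term Y u.2 v.2).tsum_add (summable_term Y u.2 w.2)
  inner_self_nonneg {u} := MulOpposite.unop_nonneg.1 (tsum_nonneg (term_self_nonneg Y u.1))
  inner_self {u} := by
    rw [← MulOpposite.unop_eq_zero_iff]
    change ∑' i, term Y u.1 u.1 i = 0 ↔ u = 0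
    constructor
    · intro h
      have hs : HasSum (term Y u.1 u.1) 0 := h ▸ u.2.hasSum
      refine carrier_ext fun i => ?_
      have h0 : term Y u.1 u.1 i = 0 :=
        le_antisymm (le_hasSum hs i fun j _ => term_self_nonneg Y u.1 j)
          (term_self_nonneg Y u.1 i)
      have h1 := norm_term_self Y u.1 i
      rw [h0, norm_zero] at h1
      exact norm_eq_zero.1 (pow_eq_zero_iff (two_ne_zero)|>.1 h1.symm)
    · rintro rfl
      have h : term Y 0 0 = 0 := by simpa using term_smul_right Y 0 0 0
      change ∑' i, term Y 0 0 i = 0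
      rw [h]
      exact tsum_zero
  inner_op_smul_right {x u v} := by
    refine MulOpposite.unop_injective ?_
    change ∑' i, term Y u.1 (fun i => MulOpposite.op (x.unop.coord (σ i)) • v.1 i) i
      = (∑' i, term Y u.1 v.1 i) * x.unop
    rw [← (summable_term Y u.2 v.2).tsum_mul_right]
    refine tsum_congr fun i => ?_
    rw [term, term, rinner_op_smul_right, C0Sum.single_mul_left]
  inner_smul_right_complex {z u v} := by
    refine MulOpposite.unop_injective ?_
    change ∑' i, term Y u.1 (z • v.1) i = z • ∑' i, term Y u.1 v.1 i
    rw [term_smul_right]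
    exact (summable_term Y u.2 v.2).tsum_const_smul z
  star_inner u v := by
    refine MulOpposite.unop_injective ?_
    change star (∑' i, term Y u.1 v.1 i) = ∑' i, term Y v.1 u.1 i
    rw [tsum_star]
    exact tsum_congr fun i => star_term Y u.1 v.1 i
  norm_eq_sqrt_norm_inner_self _ := rfl

instance : NormedAddCommGroup (Carrier Y) :=
  NormedAddCommGroup.ofCore (CStarModule.normedSpaceCore (C0Sum A)ᵐᵒᵖ)

instance : NormedSpace ℂ (Carrier Y) :=
  NormedSpace.ofCore (CStarModule.normedSpaceCore (C0Sum A)ᵐᵒᵖ)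

theorem rinner_eq (u v : Carrier Y) : rinner (C0Sum A) u v = ∑' i, term Y u.1 v.1 i := rfl

theorem norm_sum_le (u : Carrier Y) (s : Finset ι) : ‖∑ i ∈ s, term Y u.1 u.1 i‖ ≤ ‖u‖ ^ 2 := by
  rw [norm_sq_eq_rinner (B := C0Sum A), rinner_eq]
  refine CStarAlgebra.norm_le_norm_of_nonneg_of_le
    (Finset.sum_nonneg fun i _ => term_self_nonneg Y u.1 i) ?_
  exact u.2.sum_le_tsum s fun i _ => term_self_nonneg Y u.1 i

theorem norm_apply_le (u : Carrier Y) (i : ι) : ‖u.1 i‖ ≤ ‖u‖ := by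
  have h := norm_sum_le Y u {i}
  rw [Finset.sum_singleton, norm_term_self] at h
  exact abs_le_of_sq_le_sq' h (norm_nonneg _) |>.2

instance : CompleteSpace (Carrier Y) := by
  refine Metric.complete_of_cauchySeq_tendsto fun u hu => ?_
  have hcoord : ∀ i, ∃ l, Tendsto (fun n => (u n).1 i) atTop (𝓝 l) := fun i => by
    refine cauchySeq_tendsto_of_complete (Metric.cauchySeq_iff'.2 fun ε hε => ?_)
    obtain ⟨N, hN⟩ := Metric.cauchySeq_iff'.1 hu ε hε
    refine ⟨N, fun n hn => lt_of_le_of_lt ?_ (hN n hn)⟩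
    rw [dist_eq_norm, dist_eq_norm]
    exact norm_apply_le Y (u n - u N) i
  choose v hv using hcoord
  have hbound : ∀ ε > 0, ∃ N, ∀ n ≥ N, ∀ s : Finset ι,
      ‖∑ i ∈ s, term Y (v - (u n).1) (v - (u n).1) i‖ ≤ ε ^ 2 := by
    intro ε hε
    obtain ⟨N, hN⟩ := Metric.cauchySeq_iff.1 hu ε hε
    refine ⟨N, fun n hn s => ?_⟩
    have hlim : Tendsto (fun m => ‖∑ i ∈ s, term Y ((u m).1 - (u n).1) ((u m).1 - (u n).1) i‖)
        atTop (𝓝 ‖∑ i ∈ s, term Y (v - (u n).1) (v - (u n).1) i‖) := by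
      refine (tendsto_finsetSum s fun i _ => ?_).norm
      refine ((C0Sum.continuous_single (σ i)).tendsto _).comp ?_
      have h1 : Tendsto (fun m => (u m).1 i - (u n).1 i) atTop (𝓝 (v i - (u n).1 i)) :=
        (hv i).sub_const _
      have h2 : Continuous fun p : Y i × Y i => rinner (A (σ i)) p.1 p.2 :=
        MulOpposite.continuous_unop.comp (CStarModule.continuous_inner (A := (A (σ i))ᵐᵒᵖ))
      exact (h2.tendsto _).comp (h1.prodMk_nhds h1)
    refine le_of_tendsto hlim (eventually_atTop.2 ⟨N, fun m hm => ?_⟩)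
    refine (norm_sum_le Y (u m - u n) s).trans ?_
    have h3 := hN m hm n hn
    rw [dist_eq_norm] at h3
    exact pow_le_pow_left₀ (norm_nonneg _) h3.le 2
  have hmem : v ∈ squareSummable Y := by
    refine summable_iff_vanishing_norm.2 fun ε hε => ?_
    obtain ⟨N, hN⟩ := hbound (Real.sqrt (ε / 8)) (by positivity)
    obtain ⟨s, hs⟩ := summable_iff_vanishing_norm.1 (u N).2 (ε / 8) (by positivity)
    refine ⟨s, fun t ht => ?_⟩
    have h1 := hN N le_rfl t
    rw [Real.sq_sqrt (by positivity)] at h1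
    have h2 := hs t ht
    have h3 : ∑ i ∈ t, term Y v v i ≤
        (2 : ℝ) • ∑ i ∈ t, term Y (v - (u N).1) (v - (u N).1) i
          + (2 : ℝ) • ∑ i ∈ t, term Y (u N).1 (u N).1 i := by
      rw [Finset.smul_sum, Finset.smul_sum, ← Finset.sum_add_distrib]
      refine Finset.sum_le_sum fun i _ => ?_
      have := term_add_self_le Y (v - (u N).1) (u N).1 i
      rwa [sub_add_cancel] at this
    have h4 := CStarAlgebra.norm_le_norm_of_nonneg_of_le
      (Finset.sum_nonneg fun i _ => term_self_nonneg Y v i) h3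
    have h5 := norm_add_le ((2 : ℝ) • ∑ i ∈ t, term Y (v - (u N).1) (v - (u N).1) i)
      ((2 : ℝ) • ∑ i ∈ t, term Y (u N).1 (u N).1 i)
    rw [norm_smul, norm_smul, Real.norm_ofNat] at h5
    linarith
  refine ⟨(⟨v, hmem⟩ : squareSummable Y), Metric.tendsto_atTop.2 fun ε hε => ?_⟩
  obtain ⟨N, hN⟩ := hbound (ε / 2) (by positivity)
  refine ⟨N, fun n hn => ?_⟩
  let v' : Carrier Y := (⟨v, hmem⟩ : squareSummable Y)
  change dist (u n) v' < ε
  rw [dist_comm, dist_eq_norm]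
  refine lt_of_le_of_lt ?_ (half_lt_self hε)
  refine abs_le_of_sq_le_sq' ?_ (by positivity) |>.2
  rw [norm_sq_eq_rinner (B := C0Sum A), rinner_eq]
  have hsum : Summable (term Y (v - (u n).1) (v - (u n).1)) :=
    (squareSummable Y).sub_mem hmem (u n).2
  exact le_of_tendsto hsum.hasSum.norm (Eventually.of_forall (hN n hn))

theorem dense_finite_support : Dense {u : Carrier Y | {i | u.1 i ≠ 0}.Finite} := by
  classical
  refine fun u => Metric.mem_closure_iff.2 fun ε hε => ?_
  obtain ⟨s, hs⟩ := summable_iff_vanishing_norm.1 u.2 ((ε / 2) ^ 2) (by positivity)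
  let w : ∀ i, Y i := fun i => if i ∈ s then u.1 i else 0
  have hw0 : ∀ i, i ∉ s → term Y w w i = 0 := fun i hi => by
    rw [← norm_eq_zero, norm_term_self]
    simp [w, hi]
  have hw : w ∈ squareSummable Y := summable_of_ne_finset_zero (s := s) hw0
  let w' : Carrier Y := (⟨w, hw⟩ : squareSummable Y)
  refine ⟨w', s.finite_toSet.subset fun i hi => ?_, ?_⟩
  · by_contra h
    exact hi (if_neg h)
  · rw [dist_eq_norm]
    refine lt_of_le_of_lt ?_ (half_lt_self hε)
    refine abs_le_of_sq_le_sq' ?_ (by positivity) |>.2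
    rw [norm_sq_eq_rinner (B := C0Sum A), rinner_eq]
    refine le_of_tendsto (u - w').2.hasSum.norm (Eventually.of_forall fun t => ?_)
    have h1 : ∀ i ∈ t, i ∉ t \ s → term Y (u - w').1 (u - w').1 i = 0 := fun i hi hi' => by
      have his : i ∈ s := by
        by_contra h
        exact hi' (Finset.mem_sdiff.2 ⟨hi, h⟩)
      rw [← norm_eq_zero, norm_term_self]
      have : (u - w').1 i = u.1 i - w i := rfl
      simp [this, w, his]
    have h2 : ∀ i ∈ t \ s, term Y (u - w').1 (u - w').1 i = term Y u.1 u.1 i := fun i hi => by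
      have : (u - w').1 i = u.1 i := by
        change u.1 i - w i = u.1 i
        simp [w, (Finset.mem_sdiff.1 hi).2]
      rw [term, term, this]
    rw [← Finset.sum_subset Finset.sdiff_subset h1, Finset.sum_congr rfl h2]
    exact (hs _ Finset.sdiff_disjoint).le

/-- The left action `(φ(a) u)_i = φ_i(a_{ρ i}) u_i`. -/
def φ : C0Sum A →ₙₐ[ℂ] (Carrier Y →L[ℂ] Carrier Y) where
  toFun a := LinearMap.mkContinuous
    { toFun := fun u => ⟨fun i => (Y i).φ (a.coord (ρ i)) (u.1 i), φ_mem Y u.2 a⟩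
      map_add' := fun u v => carrier_ext fun i => map_add ((Y i).φ (a.coord (ρ i))) _ _
      map_smul' := fun c u => carrier_ext fun i => map_smul ((Y i).φ (a.coord (ρ i))) _ _ }
    ‖a‖ fun u => by
      refine abs_le_of_sq_le_sq' ?_ (by positivity) |>.2
      rw [norm_sq_eq_rinner (B := C0Sum A), mul_pow, norm_sq_eq_rinner (B := C0Sum A) u,
        rinner_eq, rinner_eq]
      have h : (∑' i, term Y (fun i => (Y i).φ (a.coord (ρ i)) (u.1 i))
          (fun i => (Y i).φ (a.coord (ρ i)) (u.1 i)) i) ≤ (‖a‖ ^ 2) • ∑' i, term Y u.1 u.1 i := by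
        rw [← u.2.tsum_const_smul (‖a‖ ^ 2)]
        exact Summable.tsum_le_tsum (term_φ_le Y a u.1) (φ_mem Y u.2 a)
          (Summable.const_smul (‖a‖ ^ 2) u.2)
      have h' := CStarAlgebra.norm_le_norm_of_nonneg_of_le (tsum_nonneg (term_self_nonneg Y _)) h
      rwa [norm_smul, norm_pow, norm_norm] at h'
  map_smul' c a := ContinuousLinearMap.ext fun u => carrier_ext fun i =>
    congrArg (fun T : Y i →L[ℂ] Y i => T (u.1 i)) (map_smul (Y i).φ c (a.coord (ρ i)))
  map_zero' := ContinuousLinearMap.ext fun u => carrier_ext fun i =>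
    congrArg (fun T : Y i →L[ℂ] Y i => T (u.1 i)) (map_zero (Y i).φ)
  map_add' a b := ContinuousLinearMap.ext fun u => carrier_ext fun i =>
    congrArg (fun T : Y i →L[ℂ] Y i => T (u.1 i)) (map_add (Y i).φ (a.coord (ρ i)) (b.coord (ρ i)))
  map_mul' a b := ContinuousLinearMap.ext fun u => carrier_ext fun i =>
    congrArg (fun T : Y i →L[ℂ] Y i => T (u.1 i)) (map_mul (Y i).φ (a.coord (ρ i)) (b.coord (ρ i)))

theorem φ_apply (a : C0Sum A) (u : Carrier Y) (i : ι) :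
    (φ Y a u).1 i = (Y i).φ (a.coord (ρ i)) (u.1 i) := rfl

end GraphSum

/-- Let `Y i` be a correspondence from `A (ρ i)` to `A (σ i)` for each `i`. Their direct sum is a
correspondence over `c₀(A)`. Its elements are the families `u` with `u_i ∈ Y i` for which
`∑ i, ⟨u_i, u_i⟩` converges in norm in `c₀(A)`, where `⟨u_i, u_i⟩` sits at the vertex `σ i`, and
`⟨u, v⟩(p) = ∑_{σ i = p} ⟨u_i, v_i⟩`, `(u x)_i = u_i x_{σ i}`, `(φ(a) u)_i = φ_i(a_{ρ i}) u_i`.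
It is the completion of the finitely supported families. -/
def graphSum {ρ σ : ι → V} (Y : ∀ i, Corr (A (ρ i)) (A (σ i))) : Corr (C0Sum A) (C0Sum A) where
  carrier := GraphSum.Carrier Y
  φ := GraphSum.φ Y
  φ_adjoint a u v := by
    rw [GraphSum.rinner_eq, GraphSum.rinner_eq]
    exact tsum_congr fun i => congrArg (C0Sum.single (σ i)) ((Y i).φ_adjoint _ _ _)

end Sum

/-! ### Directed graphs and contractibility -/

/-- A directed graph with vertex set `V`, edge set `E`, range map `r` and source map `s`. -/
structure DirectedGraph (V E : Type u) where
  r : E → V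
  s : E → V

namespace DirectedGraph

variable {V E : Type u} (G : DirectedGraph V E)

/-- Any two vertices are joined by an undirected path. -/
def Connected : Prop := ∀ p q, Relation.EqvGen (fun a b => ∃ e, G.s e = a ∧ G.r e = b) p q

/-- `w 0, w 1, w 2, …` is an infinite path, which ends at `r (w 0)`. -/
def IsInfinitePath (w : ℕ → E) : Prop := ∀ n, G.s (w n) = G.r (w (n + 1))

/-- A Cuntz–Krieger family for `G` in the C⋆-algebra `B`. -/
structure CKFamily (B : Type u) [NonUnitalCStarAlgebra B] where
  P : V → B
  S : E → B
  isStarProjection_P : ∀ p, IsStarProjection (P p)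
  partialIsometry_S : ∀ e, S e * star (S e) * S e = S e
  P_mul_P : ∀ p q, p ≠ q → P p * P q = 0
  star_S_mul_S : ∀ e f, e ≠ f → star (S e) * S f = 0
  star_S_mul_self : ∀ e, star (S e) * S e = P (G.s e)
  /-- The inequality of projections `S e * star (S e) ≤ P (r e)`. -/
  S_mul_star_le : ∀ e, P (G.r e) * (S e * star (S e)) = S e * star (S e)
  sum_S_mul_star : ∀ p (h : {e | G.r e = p}.Finite), {e | G.r e = p}.Nonempty →
    ∑ e ∈ h.toFinset, S e * star (S e) = P p

variable {G}

/-- `F` exhibits `B` as the universal C⋆-algebra `O_G` of Cuntz–Krieger families for `G`. -/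
structure CKFamily.IsUniversal {B : Type u} [NonUnitalCStarAlgebra B] (F : G.CKFamily B) :
    Prop where
  generates :
    (NonUnitalStarAlgebra.adjoin ℂ (range F.P ∪ range F.S)).topologicalClosure = ⊤
  exists_lift : ∀ (C : Type u) [NonUnitalCStarAlgebra C] (F' : G.CKFamily C),
    ∃ f : B →⋆ₙₐ[ℂ] C, (∀ p, f (F.P p) = F'.P p) ∧ ∀ e, f (F.S e) = F'.S e

variable (G)

/-- `G` is contractible at `p₀`: in the universal algebra `B = O_G` of the graph, with `P₀` the
projection of `p₀`, the subalgebra `ℂ P₀` is a full corner, that is `P₀ B P₀ = ℂ P₀` and the closed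
two-sided ideal spanned by `B P₀ B` is `B`. -/
def ContractibleAt (p₀ : V) : Prop :=
  ∃ (B : Type u) (_ : NonUnitalCStarAlgebra B) (F : G.CKFamily B), F.IsUniversal ∧
    {b | ∃ x, b = F.P p₀ * x * F.P p₀} = {b | ∃ c : ℂ, b = c • F.P p₀} ∧
    (Submodule.span ℂ {b | ∃ x y, b = x * F.P p₀ * y}).topologicalClosure = ⊤

/-- The graphs along which a tail is added at `p₀`: connected, without sources (every vertex
receives an edge), with `p₀` a sink (no edge starts at `p₀`), and contractible at `p₀`. -/
structure IsTailGraph (p₀ : V) : Prop where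
  connected : G.Connected
  no_sources : ∀ p, ∃ e, G.r e = p
  sink : ∀ e, G.s e ≠ p₀
  contractible : G.ContractibleAt p₀

end DirectedGraph

/-! ### Adding a tail -/

section Tail

variable {V E : Type u} {A : V → Type u} [∀ p, NonUnitalCStarAlgebra (A p)]
  [∀ p, PartialOrder (A p)] [∀ p, StarOrderedRing (A p)] {G : DirectedGraph V E} {p₀ : V}

/-- The correspondences that make up `X_τ`: `X`, from `A p₀` to itself, at `none`, and `Y e`, from
`A (r e)` to `A (s e)`, at `some e`. -/
def tailFamily (X : Corr (A p₀) (A p₀)) (Y : ∀ e, Corr (A (G.r e)) (A (G.s e))) :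
    ∀ i : Option E, Corr (A (i.elim p₀ G.r)) (A (i.elim p₀ G.s))
  | none => X
  | some e => Y e

/-- `(X_τ, A_τ, φ_τ)`, where `X_τ = X ⊕ T₁` and `A_τ = A p₀ ⊕ T₀`, with `T₀` the `c₀`-sum of the
`A p` for `p ≠ p₀`. Thus `A_τ` is the `c₀`-sum of all `A p`, and an element `u` of `X_τ` has the
components `u_none ∈ X` and `u_e ∈ Y e`. -/
def addTail (X : Corr (A p₀) (A p₀)) (Y : ∀ e, Corr (A (G.r e)) (A (G.s e))) :
    Corr (C0Sum A) (C0Sum A) :=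
  graphSum (tailFamily X Y)

/-- `φ_e` for an edge `e` that ends at `p₀`, as a correspondence from `A p₀` to `A (s e)`. -/
def edgeInto (Y : ∀ e, Corr (A (G.r e)) (A (G.s e))) (e : E) (h : G.r e = p₀) :
    Corr (A p₀) (A (G.s e)) :=
  h ▸ Y e

variable (X : Corr (A p₀) (A p₀)) (Y : ∀ e, Corr (A (G.r e)) (A (G.s e)))

/-- The family underlying `ξ ⊕ 0 ∈ X ⊕ T₁`. -/
def inclFun (ξ : X) : ∀ i, tailFamily X Y i
  | none => ξ
  | some _ => 0

theorem term_inclFun (ξ η : X) (i : Option E) (hi : i ≠ none) :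
    GraphSum.term (tailFamily X Y) (inclFun X Y ξ) (inclFun X Y η) i = 0 := by
  cases i with
  | none => exact absurd rfl hi
  | some e =>
    have h : rinner (A (G.s e)) (0 : Y e) 0 = 0 := rinner_self_eq_zero.2 rfl
    exact (congrArg (C0Sum.singleHom A (G.s e)) h).trans (map_zero _)

theorem inclFun_mem (ξ : X) : inclFun X Y ξ ∈ GraphSum.squareSummable (tailFamily X Y) :=
  summable_of_ne_finset_zero (s := {none}) fun i hi =>
    term_inclFun X Y ξ ξ i fun h => hi (Finset.mem_singleton.2 h)

/-- The inclusion `ξ ↦ ξ ⊕ 0` of `X` in `X_τ`. -/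
def incl : X →ₗ[ℂ] addTail X Y where
  toFun ξ := (⟨inclFun X Y ξ, inclFun_mem X Y ξ⟩ : GraphSum.squareSummable (tailFamily X Y))
  map_add' ξ η := GraphSum.carrier_ext fun i => by
    cases i with
    | none => rfl
    | some e => exact (add_zero (0 : Y e)).symm
  map_smul' c ξ := GraphSum.carrier_ext fun i => by
    cases i with
    | none => rfl
    | some e => exact (smul_zero (A := Y e) c).symm

theorem rinner_incl (ξ η : X) :
    rinner (C0Sum A) (incl X Y ξ) (incl X Y η) = C0Sum.single p₀ (rinner (A p₀) ξ η) :=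
  tsum_eq_single (f := GraphSum.term (tailFamily X Y) (inclFun X Y ξ) (inclFun X Y η)) none
    (term_inclFun X Y ξ η)

theorem φ_incl (a : A p₀) (ξ : X) :
    (addTail X Y).φ (C0Sum.single p₀ a) (incl X Y ξ) = incl X Y (X.φ a ξ) := by
  refine GraphSum.carrier_ext fun i => ?_
  cases i with
  | none =>
    change X.φ ((C0Sum.single p₀ a).coord p₀) ξ = X.φ a ξ
    rw [C0Sum.single_self]
  | some e => exact map_zero ((Y e).φ ((C0Sum.single p₀ a).coord (G.r e)))

variable {X Y}

/-- The restriction `(π|_A, t|_X)` of a representation of `X_τ`, where `A = A p₀`. -/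
def ToeplitzRep.restrict {C : Type u} [NonUnitalCStarAlgebra C] (R : ToeplitzRep (addTail X Y) C) : ToeplitzRep X C where
  π := R.π.comp (C0Sum.singleHom A p₀)
  t := R.t.comp (incl X Y)
  π_mul_t a ξ := (R.π_mul_t _ _).trans (congrArg R.t (φ_incl X Y a ξ))
  star_t_mul_t ξ η := (R.star_t_mul_t _ _).trans (congrArg R.π (rinner_incl X Y ξ η))

end Tail

end CStarTail

end

open CStarTail

noncomputable section

namespace CStarTail

/-! ### Cuntz–Krieger families have nonzero partial isometries -/

section PathSpace

variable {W : Type u}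

/-! The first inclusion rests on the fact that covariant representations of the injective
correspondence `X_τ` separate the points of `A_τ` (`exists_covariant_ne_zero`). Suppose `a ∈ J_X`
and `φ₁(a) y ≠ 0`. Put `y` in its summand of `X_τ` and let `v ≠ 0` be its image under `a`; choose a
covariant `(π, t)` with `π ⟨v, v⟩ ≠ 0`. Since the restriction to `X` is covariant, `π(a) =
ψ_t(φ_X(a))` is a limit of sums of operators `t(ξ) t(η)⋆`. These kill `t(y)`, because `X` is
orthogonal to `y`. Hence `t(v) = π(a) t(y) = 0`, contradicting `π ⟨v, v⟩ = t(v)⋆ t(v) ≠ 0`.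

For the second inclusion, if `φ₁(a) = 0` and `φ_X(b) = 0`, then `ab` acts as zero on `X` and on
`X₁`. Contractibility leaves no other edge ending at `p₀` (`IsTailGraph.edge_unique`): distinct
edges there would give nonzero orthogonal projections in the one-dimensional corner at `p₀`. So
`φ_τ(ab) = 0`, and injectivity gives `ab = 0`. The third inclusion compresses a compact operator on
`X_τ` to the summand `X` (`preK_of_single_mem_preK`).

The separation result starts from a faithful Hilbert space representation, induced repeatedly
through the tensor powers of the correspondence. Injectivity keeps every level faithful. The
resulting Fock representation satisfies covariance only up to operators that see nothing but level
zero. Take vectors at levels tending to infinity on which a given `c ≠ 0` stays bounded below, and a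
limit of their vector functionals. On the algebra of operators that do not bring such sequences back
to finite levels, the GNS representation of this limit kills the defects of covariance and does not
kill `c`. -/

theorem sum_pequiv_le (g : PEquiv W W) (f : lp (fun _ : W => ℂ) 2) (s : Finset W) :
    ∑ w ∈ s, ‖(g w).elim 0 f‖ ^ (2 : ℝ≥0∞).toReal ≤ ‖f‖ ^ (2 : ℝ≥0∞).toReal := by
  classical
  let j : W → W := fun w => (g w).getD w
  have h2 : (0 : ℝ) < (2 : ℝ≥0∞).toReal := by norm_num
  -- A partial bijection never repeats a coordinate, so a finite sum for `f ∘ g` is a finite sum for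
  -- `f`. The default value `w` of `j` is irrelevant: only points in the domain of `g` are kept.
  have hj : Set.InjOn j (s.filter fun w => (g w).isSome) := by
    intro a ha b hb hab
    obtain ⟨c, hc⟩ := Option.isSome_iff_exists.1 (Finset.mem_filter.1 ha).2
    obtain ⟨d, hd⟩ := Option.isSome_iff_exists.1 (Finset.mem_filter.1 hb).2
    simp only [j, hc, hd, Option.getD_some] at hab
    subst hab
    exact g.inj hc hd
  calc ∑ w ∈ s, ‖(g w).elim 0 f‖ ^ (2 : ℝ≥0∞).toReal
      = ∑ w ∈ s.filter fun w => (g w).isSome, ‖f (j w)‖ ^ (2 : ℝ≥0∞).toReal := by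
        rw [Finset.sum_filter]
        refine Finset.sum_congr rfl fun w _ => ?_
        rcases h : g w with _ | c
        · simp
        · simp [j, h]
    _ = ∑ w ∈ (s.filter fun w => (g w).isSome).image j, ‖f w‖ ^ (2 : ℝ≥0∞).toReal :=
        (Finset.sum_image (f := fun w => ‖f w‖ ^ (2 : ℝ≥0∞).toReal) hj).symm
    _ ≤ ‖f‖ ^ (2 : ℝ≥0∞).toReal := lp.sum_rpow_le_norm_rpow h2 f _

/-- The partial isometry `f ↦ f ∘ g` of `ℓ²(W)` given by a partial bijection `g` of `W`. -/
def pequivOp (g : PEquiv W W) : lp (fun _ : W => ℂ) 2 →L[ℂ] lp (fun _ : W => ℂ) 2 :=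
  LinearMap.mkContinuous
    { toFun := fun f => ⟨fun w => (g w).elim 0 f, memℓp_gen' (sum_pequiv_le g f)⟩
      map_add' := fun x y => lp.ext <| funext fun w => by
        change (g w).elim 0 (x + y : lp (fun _ : W => ℂ) 2) = (g w).elim 0 x + (g w).elim 0 y
        cases g w <;> simp [Option.elim]
      map_smul' := fun c x => lp.ext <| funext fun w => by
        change (g w).elim 0 (c • x : lp (fun _ : W => ℂ) 2) = c • (g w).elim 0 x
        cases g w <;> simp }
    1 fun f => by
      rw [one_mul]
      exact lp.norm_le_of_forall_sum_le (by norm_num) (norm_nonneg _) (sum_pequiv_le g f)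

theorem pequivOp_apply (g : PEquiv W W) (f : lp (fun _ : W => ℂ) 2) (w : W) :
    pequivOp g f w = (g w).elim 0 f := rfl

theorem pequivOp_ne_zero {g : PEquiv W W} {a b : W} (h : g a = some b) : pequivOp g ≠ 0 := by
  classical
  intro h0
  have := congrArg (fun T => T (lp.single 2 b (1 : ℂ)) a) h0
  simp [pequivOp_apply, h] at this

/-- Both inner products are sums over the graph of `g`, one indexed by its domain and the other by
its range. -/
theorem star_pequivOp (g : PEquiv W W) : star (pequivOp g) = pequivOp g.symm := by
  classical
  refine (ContinuousLinearMap.eq_adjoint_iff _ _).2 (fun x y => ?_) |>.symm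
  rw [lp.inner_eq_tsum, lp.inner_eq_tsum]
  simp only [pequivOp_apply]
  let S : Set W := {w | (g.symm w).isSome}
  let S' : Set W := {w | (g w).isSome}
  rw [← tsum_subtype_eq_of_support_subset (s := S), ← tsum_subtype_eq_of_support_subset (s := S')]
  · let e : S ≃ S' :=
      { toFun := fun w => ⟨(g.symm w).get w.2, by
          have : g ((g.symm w).get w.2) = some w := g.eq_some_iff.1 (Option.some_get w.2).symm
          simp [S', this]⟩
        invFun := fun w => ⟨(g w).get w.2, by
          have : g.symm ((g w).get w.2) = some w := g.eq_some_iff.2 (Option.some_get w.2).symm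
          simp [S, this]⟩
        left_inv := fun w => by
          have : g ((g.symm w).get w.2) = some w := g.eq_some_iff.1 (Option.some_get w.2).symm
          simp [this]
        right_inv := fun w => by
          have : g.symm ((g w).get w.2) = some w := g.eq_some_iff.2 (Option.some_get w.2).symm
          simp [this] }
    rw [← e.tsum_eq]
    refine tsum_congr fun w => ?_
    obtain ⟨v, hv⟩ := Option.isSome_iff_exists.1 w.2
    have hg : g v = some w := g.eq_some_iff.1 hv
    have he : (e w : W) = v := by simp [e, hv]
    rw [he, hv, hg]
    rfl
  · intro w hw
    by_contra h
    have h' : g w = none := by simpa [S'] using h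
    exact hw (by simp [h'])
  · intro w hw
    by_contra h
    have h' : g.symm w = none := by simpa [S] using h
    exact hw (by simp [h'])

/-! ### Infinite paths and their Cuntz–Krieger family -/

variable {V E : Type u} (G : DirectedGraph V E)

/-- The infinite paths of a directed graph. -/
abbrev PathSpace : Type u := {w : ℕ → E // G.IsInfinitePath w}

namespace PathSpace

variable {G}

/-- The path without its first edge. -/
def tail (w : PathSpace G) : PathSpace G := ⟨fun n => w.1 (n + 1), fun n => w.2 (n + 1)⟩

/-- The path `e w`. -/
def cons (e : E) (w : PathSpace G) (h : G.s e = G.r (w.1 0)) : PathSpace G :=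
  ⟨fun n => Nat.casesOn n e w.1, fun n => by
    cases n with
    | zero => exact h
    | succ n => exact w.2 n⟩

theorem cons_tail (w : PathSpace G) : cons (w.1 0) (tail w) (w.2 0) = w :=
  Subtype.ext <| funext fun n => by cases n <;> rfl

open Classical in
/-- Removing `e` from the paths that begin with `e`. -/
def edgePEquiv (e : E) : PEquiv (PathSpace G) (PathSpace G) where
  toFun w := if w.1 0 = e then some (tail w) else none
  invFun w := if h : G.s e = G.r (w.1 0) then some (cons e w h) else none
  inv a b := by
    constructor
    · intro h
      by_cases hb : G.s e = G.r (b.1 0)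
      · rw [dif_pos hb, Option.some_inj] at h
        subst h
        exact if_pos rfl
      · rw [dif_neg hb] at h
        exact absurd h (by simp)
    · intro h
      by_cases ha : a.1 0 = e
      · rw [if_pos ha, Option.some_inj] at h
        subst h
        subst ha
        rw [dif_pos (by exact a.2 0), cons_tail]
      · rw [if_neg ha] at h
        exact absurd h (by simp)

open Classical in
theorem edgePEquiv_apply (e : E) (w : PathSpace G) :
    edgePEquiv e w = if w.1 0 = e then some (tail w) else none := rfl

open Classical in
theorem edgePEquiv_symm_apply (e : E) (w : PathSpace G) : (edgePEquiv e).symm w =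
    if h : G.s e = G.r (w.1 0) then some (cons e w h) else none := rfl

open Classical in
/-- The projection of `ℓ²` of the path space onto the functions supported in `s`. -/
def proj (s : Set (PathSpace G)) :
    lp (fun _ : PathSpace G => ℂ) 2 →L[ℂ] lp (fun _ : PathSpace G => ℂ) 2 :=
  pequivOp (PEquiv.ofSet s)

open Classical in
theorem proj_apply (s : Set (PathSpace G)) (f : lp (fun _ : PathSpace G => ℂ) 2)
    (w : PathSpace G) : proj s f w = if w ∈ s then f w else 0 := by
  change (if w ∈ s then some w else none : Option (PathSpace G)).elim 0 f = _
  split_ifs <;> rfl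

theorem proj_mul_proj (s t : Set (PathSpace G)) : proj s * proj t = proj (s ∩ t) := by
  classical
  refine ContinuousLinearMap.ext fun f => lp.ext <| funext fun w => ?_
  rw [mul_apply_eq_comp, proj_apply, proj_apply, proj_apply, ← ite_and]
  congr 1

theorem proj_empty : proj (∅ : Set (PathSpace G)) = 0 :=
  ContinuousLinearMap.ext fun f => lp.ext <| funext fun w => by
    rw [proj_apply, if_neg (Set.notMem_empty w)]
    rfl

theorem isStarProjection_proj (s : Set (PathSpace G)) : IsStarProjection (proj s) where
  isIdempotentElem := by rw [IsIdempotentElem, proj_mul_proj, Set.inter_self]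
  isSelfAdjoint := by
    classical
    rw [isSelfAdjoint_iff, proj, star_pequivOp, PEquiv.ofSet_symm]

theorem tail_cons (e : E) (w : PathSpace G) (h : G.s e = G.r (w.1 0)) :
    tail (cons e w h) = w := rfl

theorem star_edge_mul_edge (e : E) : star (pequivOp (edgePEquiv e)) * pequivOp (edgePEquiv e)
    = proj {w : PathSpace G | G.r (w.1 0) = G.s e} := by
  classical
  refine ContinuousLinearMap.ext fun f => lp.ext <| funext fun w => ?_
  rw [star_pequivOp, mul_apply_eq_comp, pequivOp_apply, proj_apply, edgePEquiv_symm_apply]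
  by_cases h : G.s e = G.r (w.1 0)
  · rw [dif_pos h, if_pos (by exact h.symm), Option.elim_some, pequivOp_apply, edgePEquiv_apply,
      if_pos (by rfl), tail_cons]
    rfl
  · rw [dif_neg h, if_neg (fun h' => h h'.symm)]
    rfl

theorem edge_mul_star_edge (e : E) : pequivOp (edgePEquiv e) * star (pequivOp (edgePEquiv e))
    = proj {w : PathSpace G | w.1 0 = e} := by
  classical
  refine ContinuousLinearMap.ext fun f => lp.ext <| funext fun w => ?_
  rw [star_pequivOp, mul_apply_eq_comp, pequivOp_apply, proj_apply, edgePEquiv_apply]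
  by_cases h : w.1 0 = e
  · rw [if_pos h, if_pos (by exact h), Option.elim_some, pequivOp_apply, edgePEquiv_symm_apply]
    subst h
    rw [dif_pos (by exact w.2 0), Option.elim_some, cons_tail]
  · rw [if_neg h, if_neg (by exact h)]
    rfl

theorem proj_mul_edge (e : E) : proj {w : PathSpace G | w.1 0 = e} * pequivOp (edgePEquiv e)
    = pequivOp (edgePEquiv e) := by
  classical
  refine ContinuousLinearMap.ext fun f => lp.ext <| funext fun w => ?_
  rw [mul_apply_eq_comp, proj_apply, pequivOp_apply, edgePEquiv_apply]
  by_cases h : w.1 0 = e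
  · exact if_pos h
  · rw [if_neg h, if_neg (by exact h)]
    rfl

/-- The two ranges consist of functions supported on paths with different first edges. -/
theorem star_edge_mul_edge_of_ne {e f : E} (hef : e ≠ f) :
    star (pequivOp (edgePEquiv e)) * pequivOp (edgePEquiv f : PEquiv (PathSpace G) _) = 0 := by
  have h := congrArg star (proj_mul_edge (G := G) e)
  rw [star_mul, (isStarProjection_proj _).isSelfAdjoint.star_eq] at h
  rw [← h, ← proj_mul_edge f, mul_assoc, ← mul_assoc (proj _) (proj _), proj_mul_proj]
  have : {w : PathSpace G | w.1 0 = e} ∩ {w | w.1 0 = f} = ∅ := by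
    ext w
    simp only [mem_inter_iff, mem_ofPred_eq, mem_empty_iff_false, iff_false, not_and]
    rintro rfl
    exact hef
  rw [this, proj_empty, zero_mul, mul_zero]

end PathSpace

/-- The Cuntz–Krieger family on `ℓ²` of the path space. -/
def pathFamily : G.CKFamily (lp (fun _ : PathSpace G => ℂ) 2 →L[ℂ] lp (fun _ : PathSpace G => ℂ) 2)
    where
  P p := PathSpace.proj {w | G.r (w.1 0) = p}
  S e := pequivOp (PathSpace.edgePEquiv e)
  isStarProjection_P p := PathSpace.isStarProjection_proj _
  partialIsometry_S e := by rw [PathSpace.edge_mul_star_edge, PathSpace.proj_mul_edge]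
  P_mul_P p q hpq := by
    rw [PathSpace.proj_mul_proj, ← PathSpace.proj_empty]
    congr 1
    ext w
    simp only [mem_inter_iff, mem_ofPred_eq, mem_empty_iff_false, iff_false, not_and]
    rintro rfl
    exact hpq
  star_S_mul_S e f := PathSpace.star_edge_mul_edge_of_ne
  star_S_mul_self := PathSpace.star_edge_mul_edge
  S_mul_star_le e := by
    rw [PathSpace.edge_mul_star_edge, PathSpace.proj_mul_proj]
    congr 1
    ext w
    simp only [mem_inter_iff, mem_ofPred_eq, and_iff_right_iff_imp]
    rintro rfl
    rfl
  sum_S_mul_star p h _ := by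
    classical
    refine ContinuousLinearMap.ext fun f => lp.ext <| funext fun w => ?_
    rw [sum_apply, lp.coeFn_sum, Finset.sum_apply, PathSpace.proj_apply]
    simp only [PathSpace.edge_mul_star_edge, PathSpace.proj_apply, mem_ofPred_eq]
    -- At a given path only the term of its first edge survives, and that edge occurs in the sum
    -- exactly when the path ends at `p`.
    rw [Finset.sum_ite_eq]
    simp

variable {G}

/-- Every vertex receives an edge, so a path can be prolonged forever at its source end. -/
theorem exists_path (h : ∀ p, ∃ e, G.r e = p) (e : E) : ∃ w : PathSpace G, w.1 0 = e := by
  choose g hg using h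
  exact ⟨⟨fun n => (fun e => g (G.s e))^[n] e, fun n => by
    change _ = G.r ((fun e => g (G.s e))^[n + 1] e)
    rw [Function.iterate_succ_apply', hg]⟩, rfl⟩

theorem pathFamily_S_ne_zero (h : ∀ p, ∃ e, G.r e = p) (e : E) : (pathFamily G).S e ≠ 0 := by
  classical
  obtain ⟨w, rfl⟩ := exists_path h e
  exact pequivOp_ne_zero (if_pos rfl)

/-- In a graph that is contractible at `p₀`, only one edge ends at `p₀`. -/
theorem _root_.CStarTail.DirectedGraph.IsTailGraph.edge_unique {p₀ : V} (hG : G.IsTailGraph p₀)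
    {e f : E} (he : G.r e = p₀) (hf : G.r f = p₀) : e = f := by
  obtain ⟨B, _, F, hF, hcorner, -⟩ := hG.contractible
  obtain ⟨Φ, -, hΦ⟩ := hF.exists_lift _ (pathFamily G)
  -- Universality maps `S_e` to the path-space operator, which is nonzero.
  have hne : ∀ e, F.S e * star (F.S e) ≠ 0 := fun e h0 => by
    refine pathFamily_S_ne_zero hG.no_sources e ?_
    rw [← hΦ, ← F.partialIsometry_S, h0, zero_mul, map_zero]
  -- A range projection below `P p₀` lies in the corner, which is one-dimensional.
  have hscalar : ∀ e, G.r e = p₀ → ∃ c : ℂ, F.S e * star (F.S e) = c • F.P p₀ := fun e he => by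
    have h1 := F.S_mul_star_le e
    rw [he] at h1
    have h2 := congrArg star h1
    rw [star_mul, star_mul, star_star, (F.isStarProjection_P p₀).isSelfAdjoint.star_eq] at h2
    have h3 : F.S e * star (F.S e) ∈ {b | ∃ x, b = F.P p₀ * x * F.P p₀} :=
      ⟨F.S e * star (F.S e), by rw [h1, h2]⟩
    rwa [hcorner] at h3
  by_contra hef
  obtain ⟨c, hc⟩ := hscalar e he
  obtain ⟨d, hd⟩ := hscalar f hf
  -- Orthogonality forces the product of the two scalars, or `P p₀` itself, to vanish; either way
  -- some range projection is zero.
  have h0 : F.S e * star (F.S e) * (F.S f * star (F.S f)) = 0 := by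
    rw [mul_assoc, ← mul_assoc (star _), F.star_S_mul_S e f hef, zero_mul, mul_zero]
  have hP := (F.isStarProjection_P p₀).isIdempotentElem.eq
  rw [hc, hd, smul_mul_smul_comm, hP, smul_eq_zero, mul_eq_zero] at h0
  rcases h0 with (h0 | h0) | h0
  · exact hne e (by rw [hc, h0, zero_smul])
  · exact hne f (by rw [hd, h0, zero_smul])
  · exact hne e (by rw [hc, h0, smul_zero])

end PathSpace

/-! ### Gram matrices -/

section Gram

variable {A : Type*} [NonUnitalCStarAlgebra A] [PartialOrder A] [StarOrderedRing A]
  {E : Type*} [NormedAddCommGroup E] [NormedSpace ℂ E] [SMul Aᵐᵒᵖ E] [CStarModule Aᵐᵒᵖ E]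
  {ι : Type*} [Fintype ι]

theorem rinner_zero_right (x : E) : rinner A x 0 = 0 := by
  have := rinner_smul_right (B := A) 0 x x
  rwa [zero_smul, zero_smul] at this

theorem rinner_sum_right {κ : Type*} (s : Finset κ) (x : E) (y : κ → E) :
    rinner A x (∑ i ∈ s, y i) = ∑ i ∈ s, rinner A x (y i) := by
  classical
  induction s using Finset.induction_on with
  | empty => simp [rinner_zero_right]
  | insert i s hi ih => rw [Finset.sum_insert hi, Finset.sum_insert hi, rinner_add_right, ih]

theorem rinner_sum_left {κ : Type*} (s : Finset κ) (x : κ → E) (y : E) :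
    rinner A (∑ i ∈ s, x i) y = ∑ i ∈ s, rinner A (x i) y := by
  rw [← star_rinner, rinner_sum_right, star_sum]
  simp only [star_rinner]

/-- The Gram matrix of a finite family. -/
def gram (A : Type*) [NonUnitalCStarAlgebra A] [PartialOrder A] [StarOrderedRing A]
    {E : Type*} [NormedAddCommGroup E] [NormedSpace ℂ E] [SMul Aᵐᵒᵖ E] [CStarModule Aᵐᵒᵖ E]
    {ι : Type*} (x : ι → E) : CStarMatrix ι ι A :=
  CStarMatrix.ofMatrix fun i j => rinner A (x i) (x j)

theorem gram_apply (x : ι → E) (i j : ι) : gram A x i j = rinner A (x i) (x j) := rfl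

/-- Conjugating by `N` is a change of vectors, so the result is again a Gram matrix. This is what
makes `nonneg_of_conjugate_eq_zero` applicable. -/
theorem star_mul_gram_mul (x : ι → E) (N : CStarMatrix ι ι A) :
    star N * gram A x * N = gram A fun j => ∑ i, MulOpposite.op (N i j) • x i := by
  refine CStarMatrix.ext fun i j => ?_
  simp only [CStarMatrix.mul_apply, CStarMatrix.star_apply, gram_apply, rinner_sum_right,
    rinner_sum_left, rinner_op_smul_left, rinner_op_smul_right, Finset.sum_mul, mul_assoc]

theorem isSelfAdjoint_gram (x : ι → E) : IsSelfAdjoint (gram A x) :=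
  CStarMatrix.ext fun i j => by rw [CStarMatrix.star_apply, gram_apply, gram_apply, star_rinner]

theorem exists_eq_star_mul_self {B : Type*} [NonUnitalCStarAlgebra B] [PartialOrder B]
    [StarOrderedRing B] {m : B} (hm : 0 ≤ m) : ∃ n, m = star n * n :=
  CStarAlgebra.nonneg_iff_eq_star_mul_self.1 hm

theorem diag_nonneg {M : CStarMatrix ι ι A} (hM : 0 ≤ M) (i : ι) : 0 ≤ M i i := by
  obtain ⟨N, rfl⟩ := exists_eq_star_mul_self hM
  rw [CStarMatrix.mul_apply]
  exact Finset.sum_nonneg fun k _ => by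
    rw [CStarMatrix.star_apply]
    exact star_mul_self_nonneg _

/-- A self-adjoint `m` is positive if `n m n ≤ 0` with `n ≥ 0` forces `n m n = 0`. -/
theorem nonneg_of_conjugate_eq_zero {B : Type*} [NonUnitalCStarAlgebra B] [PartialOrder B]
    [StarOrderedRing B] {m : B} (hm : IsSelfAdjoint m)
    (h : ∀ n, 0 ≤ n → n * m * n ≤ 0 → n * m * n = 0) : 0 ≤ m := by
  -- The test element is `n = m⁻`: then `n m n = -(m⁻)³ ≤ 0`, so the hypothesis gives `(m⁻)³ = 0`,
  -- and the C⋆-identity brings this down to `m⁻ = 0`.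
  have hneg : 0 ≤ m⁻ := CFC.negPart_nonneg m
  have hstar : star m⁻ = m⁻ := hneg.isSelfAdjoint.star_eq
  have h1 : m⁻ * m * m⁻ = - (m⁻ * m⁻ * m⁻) := by
    have : m⁻ * m = - (m⁻ * m⁻) := by
      conv_lhs => enter [2]; rw [← CFC.posPart_sub_negPart m hm]
      rw [mul_sub, CFC.negPart_mul_posPart, zero_sub]
    rw [this, neg_mul]
  have h3 : 0 ≤ m⁻ * m⁻ * m⁻ := by
    have := star_left_conjugate_nonneg hneg m⁻
    rwa [hstar] at this
  have h5 : m⁻ * m⁻ * m⁻ = 0 := by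
    rw [← neg_eq_zero, ← h1]
    exact h _ hneg (by rw [h1]; exact neg_nonpos.2 h3)
  have h6 : m⁻ * m⁻ = 0 := by
    rw [← CStarRing.star_mul_self_eq_zero_iff, star_mul, hstar, ← mul_assoc, h5, zero_mul]
  have h7 : m⁻ = 0 := by
    rw [← CStarRing.star_mul_self_eq_zero_iff, hstar, h6]
  exact (CFC.negPart_eq_zero_iff m hm).1 h7

/-- If `N G N ≤ 0`, its diagonal entries `⟨x', x'⟩` are both nonnegative and nonpositive. So the
transformed vectors vanish, and with them the whole matrix `N G N`. -/
theorem gram_nonneg (x : ι → E) : 0 ≤ gram A x := by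
  refine nonneg_of_conjugate_eq_zero (isSelfAdjoint_gram x) fun N hN hle => ?_
  have h2 := star_mul_gram_mul x N
  rw [hN.isSelfAdjoint.star_eq] at h2
  have h4 : ∀ j, ∑ i, MulOpposite.op (N i j) • x i = 0 := fun j => by
    rw [← rinner_self_eq_zero (B := A)]
    refine le_antisymm ?_ (rinner_self_nonneg _)
    have := diag_nonneg (neg_nonneg.2 hle) j
    rw [h2] at this
    exact neg_nonneg.1 this
  rw [h2]
  refine CStarMatrix.ext fun i j => ?_
  rw [gram_apply, h4, h4, rinner_zero_right]
  rfl

theorem exists_gram_eq (x : ι → E) :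
    ∃ b : ι → ι → A, ∀ i j, rinner A (x i) (x j) = ∑ k, star (b k i) * b k j := by
  obtain ⟨N, hN⟩ := exists_eq_star_mul_self (gram_nonneg (A := A) x)
  refine ⟨fun k i => N k i, fun i j => ?_⟩
  rw [← gram_apply x, hN, CStarMatrix.mul_apply]
  simp only [CStarMatrix.star_apply]

/-- For a representation `π`, the kernel `π ⟨x, y⟩` is positive. -/
theorem sum_inner_rinner_nonneg {H : Type*} [NormedAddCommGroup H] [InnerProductSpace ℂ H]
    [CompleteSpace H] (π : A →⋆ₙₐ[ℂ] (H →L[ℂ] H)) (x : ι → E) (h : ι → H) :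
    0 ≤ RCLike.re (∑ i, ∑ j, inner ℂ (π (rinner A (x j) (x i)) (h i)) (h j)) := by
  obtain ⟨b, hb⟩ := exists_gram_eq (A := A) x
  -- Factoring the Gram matrix as `b⋆ b` turns the double sum into a sum of squared norms.
  have key : ∑ i, ∑ j, inner ℂ (π (rinner A (x j) (x i)) (h i)) (h j)
      = ∑ k, inner ℂ (∑ i, π (b k i) (h i)) (∑ j, π (b k j) (h j)) := by
    simp only [hb, map_sum, map_mul, map_star, sum_apply,
      mul_apply_eq_comp, sum_inner, inner_sum, ContinuousLinearMap.star_eq_adjoint,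
      ContinuousLinearMap.adjoint_inner_left]
    calc _ = ∑ i, ∑ k, ∑ j, inner ℂ (π (b k i) (h i)) (π (b k j) (h j)) :=
          Finset.sum_congr rfl fun _ _ => Finset.sum_comm
      _ = ∑ k, ∑ i, ∑ j, inner ℂ (π (b k i) (h i)) (π (b k j) (h j)) := Finset.sum_comm
      _ = _ := Finset.sum_congr rfl fun _ _ => Finset.sum_comm
  rw [key, map_sum]
  exact Finset.sum_nonneg fun k _ => inner_self_nonneg

end Gram

/-! ### Induced representations -/

/-- A representation of a C⋆-algebra on a Hilbert space. -/
structure HilbRep (A : Type u) [NonUnitalCStarAlgebra A] : Type (u + 1) where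
  H : Type u
  [normedGroup : NormedAddCommGroup H]
  [innerSpace : InnerProductSpace ℂ H]
  [complete : CompleteSpace H]
  π : A →⋆ₙₐ[ℂ] (H →L[ℂ] H)

attribute [instance] HilbRep.normedGroup HilbRep.innerSpace HilbRep.complete

section Induced

variable {A : Type u} [NonUnitalCStarAlgebra A] [PartialOrder A] [StarOrderedRing A]

/-- A Hilbert space `K` is spanned by vectors `T x h` that behave like the elementary tensors
`x ⊗ h` of `X ⊗ H`. -/
structure IsTensor (X : Corr A A) (Θ : HilbRep A) {K : Type u} [NormedAddCommGroup K]
    [InnerProductSpace ℂ K] (T : X → Θ.H →L[ℂ] K) : Prop where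
  inner_eq : ∀ x y h k, inner ℂ (T x h) (T y k) = inner ℂ h (Θ.π (rinner A x y) k)
  dense : Dense (Submodule.span ℂ {v | ∃ x h, T x h = v} : Set K)

theorem posSemidef_kernel (X : Corr A A) (Θ : HilbRep A) :
    (Matrix.of fun x y : X => Θ.π (rinner A x y)).PosSemidef := by
  refine ((RKHS.posSemidef_tfae (K := Matrix.of fun x y : X => Θ.π (rinner A x y))).out 2 0 :).1
    ⟨?_, fun v => ?_⟩
  · refine Matrix.IsHermitian.ext fun x y => ?_
    rw [Matrix.of_apply, Matrix.of_apply, ← map_star, star_rinner]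
  · have h := sum_inner_rinner_nonneg (A := A) Θ.π (fun x : v.support => (x : X))
      (fun x => v x)
    have e : ∑ x : v.support, ∑ y : v.support, inner ℂ (Θ.π (rinner A (y : X) x) (v x)) (v y)
        = ∑ x ∈ v.support, ∑ y ∈ v.support, inner ℂ (Θ.π (rinner A y x) (v x)) (v y) := by
      rw [← Finset.sum_coe_sort v.support]
      exact Finset.sum_congr rfl fun x _ => Finset.sum_coe_sort v.support
        fun y : X => inner ℂ (Θ.π (rinner A y (x : X)) (v x)) (v y)
    rw [e] at h
    exact h

/-- The space `X ⊗ H` is realized as the reproducing kernel Hilbert space of the operator-valued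
kernel `(x, y) ↦ π ⟨x, y⟩`; its kernel functions serve as elementary tensors. -/
theorem exists_isTensor (X : Corr A A) (Θ : HilbRep A) :
    ∃ (K : Type u) (_ : NormedAddCommGroup K) (_ : InnerProductSpace ℂ K) (_ : CompleteSpace K)
      (T : X → Θ.H →L[ℂ] K), IsTensor X Θ T := by
  let M := Matrix.of fun x y : X => Θ.π (rinner A x y)
  have : Fact M.PosSemidef := ⟨posSemidef_kernel X Θ⟩
  refine ⟨RKHS.OfKernel M, inferInstance, inferInstance, inferInstance,
    RKHS.kerFun (RKHS.OfKernel M), ⟨fun x y h k => ?_, ?_⟩⟩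
  · rw [← RKHS.kernel_inner, RKHS.OfKernel.kernel_ofKernel, show M y x = Θ.π (rinner A y x) from rfl,
      ← star_rinner, map_star, ContinuousLinearMap.star_eq_adjoint, ContinuousLinearMap.adjoint_inner_left]
  · rw [dense_iff_closure_eq, ← Submodule.topologicalClosure_coe, RKHS.kerFun_dense]
    rfl

namespace IsTensor

variable {X : Corr A A} {Θ : HilbRep A} {K : Type u} [NormedAddCommGroup K]
    [InnerProductSpace ℂ K] {T : X → Θ.H →L[ℂ] K}

theorem clm_ext (hT : IsTensor X Θ T) {F : Type*} [NormedAddCommGroup F]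
    [NormedSpace ℂ F] {S S' : K →L[ℂ] F}
    (h : ∀ x k, S (T x k) = S' (T x k)) : S = S' :=
  ContinuousLinearMap.ext_on hT.dense (by rintro _ ⟨x, k, rfl⟩; exact h x k)

theorem vec_ext (hT : IsTensor X Θ T) {u v : K}
    (h : ∀ x k, inner ℂ (T x k) u = inner ℂ (T x k) v) : u = v := by
  refine hT.dense.eq_of_inner_right (𝕜 := ℂ) fun w hw => ?_
  induction hw using Submodule.span_induction with
  | mem x hx => obtain ⟨x, k, rfl⟩ := hx; exact h x k
  | zero => simp
  | add x y _ _ hx hy => rw [inner_add_left, inner_add_left, hx, hy]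
  | smul c x _ hx => rw [inner_smul_left, inner_smul_left, hx]

/-- Linearity in `x` is not assumed in `IsTensor`: it follows because inner products against the
total set of elementary tensors determine a vector. -/
theorem map_add (hT : IsTensor X Θ T) (x y : X) : T (x + y) = T x + T y :=
  ContinuousLinearMap.ext fun k => hT.vec_ext fun z l => by
    rw [add_apply, inner_add_right, hT.inner_eq, hT.inner_eq, hT.inner_eq, rinner_add_right,
      _root_.map_add, add_apply, inner_add_right]

theorem map_smul (hT : IsTensor X Θ T) (c : ℂ) (x : X) : T (c • x) = c • T x :=
  ContinuousLinearMap.ext fun k => hT.vec_ext fun z l => by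
    rw [smul_apply, inner_smul_right, hT.inner_eq, hT.inner_eq, rinner_smul_right,
      _root_.map_smul, smul_apply, inner_smul_right]

/-- The operators `T x` as a linear map in `x`. -/
def linearMap (hT : IsTensor X Θ T) : X →ₗ[ℂ] (Θ.H →L[ℂ] K) where
  toFun := T
  map_add' := hT.map_add
  map_smul' := hT.map_smul

variable (T) in
/-- The formal sums of elementary tensors, acted on by `S`. -/
def sumMap (S : X →ₗ[ℂ] X) : (X × Θ.H →₀ ℂ) →ₗ[ℂ] K :=
  Finsupp.linearCombination ℂ fun p => T (S p.1) p.2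

/-- Inner products of elementary tensors depend only on the `A`-valued inner products, so identities
in `X` carry over to formal sums of tensors. -/
theorem inner_sumMap (hT : IsTensor X Θ T) {S S' R R' : X →ₗ[ℂ] X}
    (h : ∀ x y, rinner A (S x) (R y) = rinner A (S' x) (R' y)) (z w : X × Θ.H →₀ ℂ) :
    inner ℂ (sumMap T S z) (sumMap T R w) = inner ℂ (sumMap T S' z) (sumMap T R' w) := by
  simp only [sumMap, Finsupp.linearCombination_apply, Finsupp.sum_inner, Finsupp.inner_sum,
    inner_smul_left, inner_smul_right, hT.inner_eq, h]

theorem sumMap_add (hT : IsTensor X Θ T) (S R : X →ₗ[ℂ] X) :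
    sumMap T (S + R) = sumMap T S + sumMap T R := by
  ext p
  simp [sumMap, hT.map_add]

theorem sumMap_smul (hT : IsTensor X Θ T) (c : ℂ) (S : X →ₗ[ℂ] X) :
    sumMap T (c • S) = c • sumMap T S := by
  ext p
  simp [sumMap, hT.map_smul]

theorem denseRange_sumMap (hT : IsTensor X Θ T) :
    DenseRange (sumMap T (LinearMap.id : X →ₗ[ℂ] X)) := by
  refine hT.dense.mono ?_
  rw [← LinearMap.coe_range, sumMap, Finsupp.range_linearCombination]
  refine Submodule.span_mono ?_
  rintro _ ⟨x, h, rfl⟩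
  exact ⟨(x, h), rfl⟩

/-- The action of `a` on `X` as a linear map. -/
abbrev leftMul (X : Corr A A) (a : A) : X →ₗ[ℂ] X := (X.φ a).toLinearMap

/-- In the unitization `‖a‖² - a⋆a = c⋆c`, whence `‖a‖² ‖z‖² - ‖a z‖² = ‖c z‖² ≥ 0`, where `c` acts
as its scalar part plus `φ` of its part in `A`. The bound makes `a ⊗ 1` well defined and continuous.
-/
theorem norm_sumMap_le (hT : IsTensor X Θ T) (a : A) (z : X × Θ.H →₀ ℂ) :
    ‖sumMap T (leftMul X a) z‖ ≤ ‖a‖ * ‖sumMap T LinearMap.id z‖ := by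
  have h := CStarAlgebra.star_mul_le_algebraMap_norm_sq (a := (a : Unitization ℂ A))
  rw [Unitization.norm_inr] at h
  obtain ⟨c, hc⟩ := CStarAlgebra.nonneg_iff_eq_star_mul_self.1 (sub_nonneg.2 h)
  have e2 : (star c * c).fst = ((‖a‖ ^ 2 : ℝ) : ℂ) := by
    rw [← hc, sub_eq_add_neg]
    simp [Unitization.algebraMap_eq_inl_comp]
  have e3 : (star c * c).snd = - (star a * a) := by
    rw [← hc, sub_eq_add_neg]
    simp [Unitization.algebraMap_eq_inl_comp]
  have key := hT.inner_sumMap (S := c.fst • LinearMap.id + leftMul X c.snd)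
    (R := c.fst • LinearMap.id + leftMul X c.snd) (S' := LinearMap.id)
    (R' := ((‖a‖ ^ 2 : ℝ) : ℂ) • LinearMap.id - leftMul X (star a * a)) (fun x y => by
      have : rinner A (c.fst • x + X.φ c.snd x) (c.fst • y + X.φ c.snd y)
          = rinner A x ((star c * c).fst • y + X.φ (star c * c).snd y) := by
        rw [rinner_add_left, rinner_smul_left, X.φ_adjoint, ← rinner_smul_right,
          ← rinner_add_right]
        congr 1
        simp only [Unitization.fst_mul, Unitization.snd_mul, Unitization.fst_star,
          Unitization.snd_star, _root_.map_add, map_mul, _root_.map_smul, smul_add, mul_smul,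
          add_apply, smul_apply, mul_apply_eq_comp]
        abel
      rw [e2, e3, map_neg, neg_apply, ← sub_eq_add_neg] at this
      exact this) z z
  have key2 := hT.inner_sumMap (S := leftMul X a) (R := leftMul X a) (S' := LinearMap.id)
    (R' := leftMul X (star a * a)) (fun x y => by
      change rinner A (X.φ a x) (X.φ a y) = rinner A x (X.φ (star a * a) y)
      rw [X.φ_adjoint, map_mul]
      rfl) z z
  have hR : sumMap T (((‖a‖ ^ 2 : ℝ) : ℂ) • LinearMap.id - leftMul X (star a * a)) z
      = ((‖a‖ ^ 2 : ℝ) : ℂ) • sumMap T LinearMap.id z - sumMap T (leftMul X (star a * a)) z := by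
    rw [sub_eq_add_neg, ← neg_one_smul ℂ (leftMul X (star a * a)), hT.sumMap_add, hT.sumMap_smul,
      hT.sumMap_smul, neg_one_smul, ← sub_eq_add_neg]
    rfl
  rw [hR, inner_sub_right, inner_smul_right, ← key2, inner_self_eq_norm_sq_to_K,
    inner_self_eq_norm_sq_to_K, inner_self_eq_norm_sq_to_K] at key
  have h3 : (‖a‖ * ‖sumMap T LinearMap.id z‖) ^ 2 - ‖sumMap T (leftMul X a) z‖ ^ 2
      = ‖sumMap T (c.fst • LinearMap.id + leftMul X c.snd) z‖ ^ 2 := by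
    refine Complex.ofReal_injective ?_
    push_cast at key ⊢
    rw [mul_pow]
    exact key.symm
  refine abs_le_of_sq_le_sq' ?_ (by positivity) |>.2
  rw [← sub_nonneg, h3]
  positivity

variable [CompleteSpace K]

/-- The operator `a ⊗ 1`. -/
def act (X : Corr A A) (T : X → Θ.H →L[ℂ] K) (a : A) : K →L[ℂ] K :=
  (sumMap T (leftMul X a)).extendOfNorm (sumMap T LinearMap.id)

theorem act_apply (hT : IsTensor X Θ T) (a : A) (x : X) (h : Θ.H) :
    act X T a (T x h) = T (X.φ a x) h := by
  have := LinearMap.extendOfNorm_eq hT.denseRange_sumMap ⟨‖a‖, hT.norm_sumMap_le a⟩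
    (Finsupp.single (x, h) 1)
  simpa [sumMap, act] using this

/-- The induced representation on `X ⊗ H`. -/
def rep (hT : IsTensor X Θ T) : HilbRep A where
  H := K
  π :=
    { toFun := act X T
      map_smul' := fun c a => hT.clm_ext fun x k => by
        simp [hT.act_apply, hT.map_smul]
      map_zero' := hT.clm_ext fun x k => by
        have := hT.map_smul 0 0
        simp only [zero_smul] at this
        simp [hT.act_apply, this]
      map_add' := fun a b => hT.clm_ext fun x k => by
        simp [hT.act_apply, hT.map_add]
      map_mul' := fun a b => hT.clm_ext fun x k => by
        rw [mul_apply_eq_comp, hT.act_apply, hT.act_apply, hT.act_apply, map_mul]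
        rfl
      map_star' := fun a => by
        refine hT.clm_ext fun x k => hT.vec_ext fun y l => ?_
        rw [ContinuousLinearMap.star_eq_adjoint, ContinuousLinearMap.adjoint_inner_right,
          hT.act_apply, hT.act_apply, hT.inner_eq, hT.inner_eq, X.φ_adjoint] }

end IsTensor

/-- Every representation on `H` induces a representation on `X ⊗ H`. -/
theorem HilbRep.exists_induced (X : Corr A A) (Θ : HilbRep A) :
    ∃ (Θ' : HilbRep A) (t : X →ₗ[ℂ] (Θ.H →L[ℂ] Θ'.H)), IsTensor X Θ (t ·) ∧
      ∀ a x h, Θ'.π a (t x h) = t (X.φ a x) h := by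
  obtain ⟨K, _, _, _, T, hT⟩ := exists_isTensor X Θ
  exact ⟨hT.rep, hT.linearMap, hT, hT.act_apply⟩

/-- If `a ⊗ 1 = 0`, then `π ⟨φ(a)x, φ(a)x⟩ = 0` for all `x`; faithfulness of `π` and injectivity of
`φ` then give `a = 0`. -/
theorem IsTensor.injective {X : Corr A A} (hX : X.IsInjective) {Θ Θ' : HilbRep A}
    {t : X →ₗ[ℂ] (Θ.H →L[ℂ] Θ'.H)} (ht : IsTensor X Θ (t ·))
    (hact : ∀ a x h, Θ'.π a (t x h) = t (X.φ a x) h) (hΘ : Function.Injective Θ.π) :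
    Function.Injective Θ'.π := by
  refine (injective_iff_map_eq_zero _).2 fun a ha => hX ?_
  rw [map_zero]
  refine ContinuousLinearMap.ext fun x => ?_
  rw [zero_apply, ← rinner_self_eq_zero (B := A)]
  refine hΘ ?_
  rw [map_zero]
  refine ContinuousLinearMap.ext fun h => ext_inner_left ℂ fun k => ?_
  rw [← ht.inner_eq, ← hact, ha]
  simp

end Induced

/-! ### Faithful representations -/

section Faithful

variable {A : Type u} [NonUnitalCStarAlgebra A] [PartialOrder A] [StarOrderedRing A]

variable (A) in
/-- The closed cone of nonnegative elements. -/
def nonnegCone : ProperCone ℝ A where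
  carrier := {a | 0 ≤ a}
  add_mem' := add_nonneg
  zero_mem' := le_rfl
  smul_mem' c _ ha := smul_nonneg c.2 ha
  isClosed' := CStarAlgebra.isClosed_nonneg

/-- Hahn–Banach separates `-a` from the closed positive cone by a real functional `f`, which is then
made complex linear. -/
theorem exists_positive_functional {a : A} (ha : 0 ≤ a) (ha0 : a ≠ 0) :
    ∃ f : A →ₚ[ℂ] ℂ, f a ≠ 0 := by
  have hmem : -a ∉ nonnegCone A := fun h : 0 ≤ -a => ha0 (le_antisymm (neg_nonneg.1 h) ha)
  obtain ⟨f, hf, hfa⟩ := ProperCone.hyperplane_separation_point (nonnegCone A) hmem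
  -- Symmetrizing with `star` kills the skew-adjoint elements, so the complexification is real on
  -- self-adjoint elements, with value `2 f`.
  let F : Module.Dual ℝ A := f.toLinearMap.comp
    (LinearMap.id + (starLinearEquiv ℝ (A := A)).toLinearMap)
  have hF : ∀ b : A, F b = f (b + star b) := fun b => rfl
  have hI : ∀ b : A, IsSelfAdjoint b → F (Complex.I • b) = 0 := fun b hb => by
    rw [hF, star_smul, hb.star_eq, Complex.star_def, Complex.conj_I, neg_smul, add_neg_cancel,
      map_zero]
  have hsa : ∀ b : A, IsSelfAdjoint b →
      (F.extendRCLike : Module.Dual ℂ A) b = ((2 * f b : ℝ) : ℂ) := fun b hb => by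
    rw [Module.Dual.extendRCLike_apply]
    have : (RCLike.I : ℂ) = Complex.I := rfl
    rw [this, hI b hb, hF, hb.star_eq, map_add, two_mul]
    simp
  refine ⟨PositiveLinearMap.mk₀ (F.extendRCLike : Module.Dual ℂ A) fun b hb => ?_, ?_⟩
  · rw [hsa b hb.isSelfAdjoint]
    have := hf b hb
    exact_mod_cast (by positivity : (0 : ℝ) ≤ 2 * f b)
  · change (F.extendRCLike : Module.Dual ℂ A) a ≠ 0
    rw [hsa a ha.isSelfAdjoint]
    rw [map_neg] at hfa
    exact_mod_cast (by linarith : (0 : ℝ) < 2 * f a).ne'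

/-- The direct sum of a family of representations. -/
def diagHom {ι : Type*} (Θ : ι → HilbRep A) :
    A →⋆ₙₐ[ℂ] (lp (fun i => (Θ i).H) 2 →L[ℂ] lp (fun i => (Θ i).H) 2) where
  toFun a := lp.mapCLM 2 (fun i => (Θ i).π a) (norm_nonneg a)
    fun i => NonUnitalStarAlgHom.norm_apply_le (Θ i).π a
  map_smul' c a := ContinuousLinearMap.ext fun f => lp.ext <| funext fun i => by simp
  map_zero' := ContinuousLinearMap.ext fun f => lp.ext <| funext fun i => by simp
  map_add' a b := ContinuousLinearMap.ext fun f => lp.ext <| funext fun i => by simp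
  map_mul' a b := ContinuousLinearMap.ext fun f => lp.ext <| funext fun i => by simp
  map_star' a := by
    refine (ContinuousLinearMap.eq_adjoint_iff _ _).2 fun f g => ?_
    rw [lp.inner_eq_tsum, lp.inner_eq_tsum]
    refine tsum_congr fun i => ?_
    change inner ℂ ((Θ i).π (star a) (f i)) (g i) = inner ℂ (f i) ((Θ i).π a (g i))
    rw [map_star, ContinuousLinearMap.star_eq_adjoint, ContinuousLinearMap.adjoint_inner_left]

/-- The value at `b` is the squared norm of the image of the class of `b`, and these classes are
dense in the GNS space. -/
theorem gns_eq_zero_iff (f : A →ₚ[ℂ] ℂ) (a : A) :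
    f.gnsNonUnitalStarAlgHom a = 0 ↔ ∀ b, f (star (a * b) * (a * b)) = 0 := by
  have key : ∀ b : A, f.gnsNonUnitalStarAlgHom a (f.toPreGNS b) = 0 ↔
      f (star (a * b) * (a * b)) = 0 := fun b => by
    rw [f.gnsNonUnitalStarAlgHom_apply_coe, ← norm_eq_zero, UniformSpace.Completion.norm_coe,
      ← pow_eq_zero_iff two_ne_zero, ← Complex.ofReal_eq_zero, Complex.ofReal_pow,
      f.preGNS_norm_sq]
    rfl
  constructor
  · intro h b
    rw [← key, h, zero_apply]
  · intro h
    refine ContinuousLinearMap.ext fun v => ?_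
    induction v using UniformSpace.Completion.induction_on with
    | hp => exact isClosed_eq (by fun_prop) (by fun_prop)
    | ih b => exact (key (f.ofPreGNS b)).2 (h _)

-- The direct sum of all GNS representations is faithful, because positive functionals detect
-- positive elements.
variable (A) in
theorem exists_faithful : ∃ Θ : HilbRep A, Function.Injective Θ.π := by
  let Θ : (A →ₚ[ℂ] ℂ) → HilbRep A := fun f => { H := f.GNS, π := f.gnsNonUnitalStarAlgHom }
  refine ⟨{ H := lp (fun f => (Θ f).H) 2, π := diagHom Θ },
    (injective_iff_map_eq_zero _).2 fun a ha => ?_⟩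
  by_contra h0
  -- With no unit available, the GNS vector on which `a` is tested is the class of `star a`.
  have h1 : star (a * star a) * (a * star a) ≠ 0 := by
    rw [Ne, CStarRing.star_mul_self_eq_zero_iff, CStarRing.mul_star_self_eq_zero_iff]
    exact h0
  obtain ⟨f, hf⟩ := exists_positive_functional (star_mul_self_nonneg _) h1
  refine hf ((gns_eq_zero_iff f a).1 ?_ _)
  classical
  refine ContinuousLinearMap.ext fun v => ?_
  have := congrArg (fun T => T (lp.single 2 f v) f) ha
  change (Θ f).π a ((lp.single 2 f v : lp (fun f => (Θ f).H) 2) f) = 0 at this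
  rwa [lp.single_apply_self] at this

end Faithful

/-! ### The map `ψ_t` of a representation -/

/-- If `b < a`, then `K (b / a) ^ 2 ^ m` tends to `0` while staying at least `1`. The constant `K`
is lost on taking roots. -/
theorem le_of_pow_two_pow_le {a b K : ℝ} (ha : 0 ≤ a) (hb : 0 ≤ b)
    (h : ∀ m : ℕ, a ^ 2 ^ m ≤ K * b ^ 2 ^ m) : a ≤ b := by
  by_contra! hlt
  have ha' : 0 < a := hb.trans_lt hlt
  have h1 : Tendsto (fun m : ℕ => K * (b / a) ^ 2 ^ m) atTop (𝓝 (K * 0)) :=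
    ((tendsto_pow_atTop_nhds_zero_of_lt_one (div_nonneg hb ha) ((div_lt_one ha').2 hlt)).comp
      (tendsto_pow_atTop_atTop_of_one_lt (one_lt_two (α := ℕ)))).const_mul K
  rw [mul_zero] at h1
  refine absurd (ge_of_tendsto' (b := 1) h1 fun m => ?_) (by norm_num)
  rw [div_pow, ← mul_div_assoc, le_div_iff₀ (by positivity), one_mul]
  exact h m

/-- A map defined on a spanning set extends to the closed span when it is bounded. -/
theorem exists_extension {D M C : Type*} [AddCommGroup D] [Module ℂ D] [NormedAddCommGroup M]
    [NormedSpace ℂ M] [NormedAddCommGroup C] [NormedSpace ℂ C] [CompleteSpace C]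
    (S : Submodule ℂ M) (e : D →ₗ[ℂ] M) (f : D →ₗ[ℂ] C)
    (hS : S = (LinearMap.range e).topologicalClosure) (hf : ∀ z, ‖f z‖ ≤ ‖e z‖) :
    ∃ ψ : S →L[ℂ] C, ∀ z (h : e z ∈ S), ψ ⟨e z, h⟩ = f z := by
  have hmem : ∀ z, e z ∈ S := fun z =>
    hS ▸ Submodule.le_topologicalClosure _ (LinearMap.mem_range_self e z)
  let e' : D →ₗ[ℂ] S := e.codRestrict _ hmem
  have he : DenseRange e' := by
    rintro ⟨T, hT⟩
    rw [Metric.mem_closure_iff]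
    intro ε hε
    rw [hS] at hT
    obtain ⟨_, ⟨z, rfl⟩, hd⟩ := Metric.mem_closure_iff.1 hT ε hε
    exact ⟨e' z, ⟨z, rfl⟩, hd⟩
  exact ⟨f.extendOfNorm e', fun z _ =>
    LinearMap.extendOfNorm_eq he ⟨1, fun z => by rw [one_mul]; exact hf z⟩ z⟩

theorem clm_eq_zero_of_closure_span {M C : Type*} [NormedAddCommGroup M] [NormedSpace ℂ M]
    [NormedAddCommGroup C] [NormedSpace ℂ C] (s : Set M)
    (L : (Submodule.span ℂ s).topologicalClosure →L[ℂ] C)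
    (h : ∀ m (hm : m ∈ s),
      L ⟨m, Submodule.le_topologicalClosure _ (Submodule.subset_span hm)⟩ = 0) : L = 0 := by
  have h1 : ∀ m (hm : m ∈ Submodule.span ℂ s),
      L ⟨m, Submodule.le_topologicalClosure _ hm⟩ = 0 := fun m hm => by
    induction hm using Submodule.span_induction with
    | mem m hm => exact h m hm
    | zero => exact map_zero L
    | add x y hx hy ihx ihy =>
      refine (map_add L ⟨x, Submodule.le_topologicalClosure _ hx⟩
        ⟨y, Submodule.le_topologicalClosure _ hy⟩).trans ?_
      rw [ihx, ihy, add_zero]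
    | smul c x hx ihx =>
      refine (map_smul L c ⟨x, Submodule.le_topologicalClosure _ hx⟩).trans ?_
      rw [ihx, smul_zero]
  refine ContinuousLinearMap.ext fun ⟨T, hT⟩ => ?_
  obtain ⟨u, hu, hlim⟩ := mem_closure_iff_seq_limit.1 hT
  have h2 : Tendsto (fun n => (⟨u n, Submodule.le_topologicalClosure _ (hu n)⟩ :
      (Submodule.span ℂ s).topologicalClosure)) atTop (𝓝 ⟨T, hT⟩) := tendsto_subtype_rng.2 hlim
  exact tendsto_nhds_unique (((L.continuous.tendsto _).comp h2).congr fun n => h1 _ (hu n))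
    tendsto_const_nhds

section Psi

variable {A : Type u} [NonUnitalCStarAlgebra A] [PartialOrder A] [StarOrderedRing A]
  {X : Corr A A} {C : Type u} [NonUnitalCStarAlgebra C] (R : ToeplitzRep X C)

theorem rankOne_apply (ξ η ζ : X) : rankOne A ξ η ζ = MulOpposite.op (rinner A η ζ) • ξ := rfl

theorem rinner_rankOne (ξ η x y : X) :
    rinner A (rankOne A ξ η x) y = rinner A x (rankOne A η ξ y) := by
  rw [rankOne_apply, rankOne_apply, rinner_op_smul_left, rinner_op_smul_right, star_rinner]

namespace ToeplitzRep

/-- Compatibility with the right action is automatic: in `d⋆ d`, for the difference `d`, all four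
products equal `π(a⋆ ⟨x, x⟩ a)`. -/
theorem t_mul_π (x : X) (a : A) : R.t x * R.π a = R.t (MulOpposite.op a • x) := by
  have h1 : star (R.π a) * star (R.t x) * (R.t x * R.π a) = R.π (star a * rinner A x x * a) := by
    rw [mul_assoc, ← mul_assoc (star (R.t x)), R.star_t_mul_t, map_mul, map_mul, map_star, mul_assoc]
  have h2 : star (R.π a) * star (R.t x) * R.t (MulOpposite.op a • x)
      = R.π (star a * rinner A x x * a) := by
    rw [mul_assoc, R.star_t_mul_t, rinner_op_smul_right, ← map_star, ← map_mul, mul_assoc]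
  have h3 : star (R.t (MulOpposite.op a • x)) * (R.t x * R.π a)
      = R.π (star a * rinner A x x * a) := by
    rw [← mul_assoc, R.star_t_mul_t, rinner_op_smul_left, ← map_mul]
  have h4 : star (R.t (MulOpposite.op a • x)) * R.t (MulOpposite.op a • x)
      = R.π (star a * rinner A x x * a) := by
    rw [R.star_t_mul_t, rinner_op_smul_left, rinner_op_smul_right, mul_assoc]
  rw [← sub_eq_zero, ← CStarRing.star_mul_self_eq_zero_iff, star_sub, star_mul, sub_mul, mul_sub,
    mul_sub, h1, h2, h3, h4, sub_self]

theorem norm_t_le (x : X) : ‖R.t x‖ ≤ ‖x‖ := by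
  refine abs_le_of_sq_le_sq' ?_ (by positivity) |>.2
  rw [sq, ← CStarRing.norm_star_mul_self, R.star_t_mul_t, norm_sq_eq_rinner (B := A)]
  exact NonUnitalStarAlgHom.norm_apply_le R.π _

variable (X) in
/-- The finite-rank operator given by a formal sum of rank-one operators. -/
def finiteRank : (X × X →₀ ℂ) →ₗ[ℂ] (X →L[ℂ] X) :=
  Finsupp.linearCombination ℂ fun p => rankOne A p.1 p.2

/-- The value of `ψ_t` on a formal sum of rank-one operators. -/
def psiSum : (X × X →₀ ℂ) →ₗ[ℂ] C :=
  Finsupp.linearCombination ℂ fun p => R.t p.1 * star (R.t p.2)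

theorem psiSum_mul_t (z : X × X →₀ ℂ) (x : X) : R.psiSum z * R.t x = R.t (finiteRank X z x) := by
  induction z using Finsupp.induction_linear with
  | zero => simp
  | add z w hz hw => simp [add_mul, hz, hw]
  | single p c =>
    have : R.t p.1 * star (R.t p.2) * R.t x = R.t (rankOne A p.1 p.2 x) := by
      rw [mul_assoc, R.star_t_mul_t, R.t_mul_π, rankOne_apply]
    simp [psiSum, finiteRank, smul_mul_assoc, this]

theorem exists_adjoint (z : X × X →₀ ℂ) : ∃ w : X × X →₀ ℂ, R.psiSum w = star (R.psiSum z) ∧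
    ∀ x y, rinner A (finiteRank X z x) y = rinner A x (finiteRank X w y) := by
  induction z using Finsupp.induction_linear with
  | zero => exact ⟨0, by simp, fun x y => by
      have h := rinner_smul_left (B := A) 0 x y
      simp only [star_zero, zero_smul] at h
      simp [h, rinner_zero_right]⟩
  | add z₁ z₂ h₁ h₂ =>
    obtain ⟨w₁, h₁, h₁'⟩ := h₁
    obtain ⟨w₂, h₂, h₂'⟩ := h₂
    exact ⟨w₁ + w₂, by simp [h₁, h₂], fun x y => by
      simp [rinner_add_left, rinner_add_right, h₁', h₂']⟩
  | single p c =>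
    exact ⟨Finsupp.single (p.2, p.1) (star c), by simp [psiSum], fun x y => by
      simp [finiteRank, rinner_smul_left, rinner_smul_right, rinner_rankOne]⟩

theorem norm_adjoint_le {T T' : X →L[ℂ] X} (h : ∀ x y, rinner A (T x) y = rinner A x (T' y)) :
    ‖T'‖ ≤ ‖T‖ := by
  refine T'.opNorm_le_bound (norm_nonneg _) fun x => ?_
  rcases eq_or_ne (T' x) 0 with h0 | h0
  · rw [h0, norm_zero]
    positivity
  · have h1 : ‖T' x‖ ^ 2 ≤ ‖T‖ * ‖T' x‖ * ‖x‖ := by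
      rw [norm_sq_eq_rinner (B := A), ← h]
      refine (norm_rinner_le _ _).trans ?_
      gcongr
      exact T.le_opNorm _
    have h2 : 0 < ‖T' x‖ := norm_pos_iff.2 h0
    refine le_of_mul_le_mul_left ?_ h2
    calc ‖T' x‖ * ‖T' x‖ = ‖T' x‖ ^ 2 := (sq _).symm
      _ ≤ _ := h1
      _ = _ := by ring

/-- A crude termwise estimate. The point is that `K` depends on the formal sum `z` but not on `G`,
so it can be applied to arbitrarily high powers. The unitization allows `c` to be a power of an
element, the zeroth included. -/
theorem exists_norm_comp_le (z : X × X →₀ ℂ) : ∃ K : ℝ, ∀ (G : X →L[ℂ] X) (c : Unitization ℂ C),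
    (∀ x, c * (R.t x : Unitization ℂ C) = (R.t (G x) : C)) →
      ‖c * (R.psiSum z : Unitization ℂ C)‖ ≤ K * ‖G‖ := by
  induction z using Finsupp.induction_linear with
  | zero => exact ⟨0, fun G c _ => by simp⟩
  | add z w hz hw =>
    obtain ⟨K, hK⟩ := hz
    obtain ⟨K', hK'⟩ := hw
    refine ⟨K + K', fun G c h => ?_⟩
    rw [map_add, Unitization.inr_add, mul_add, add_mul]
    exact (norm_add_le _ _).trans (add_le_add (hK G c h) (hK' G c h))
  | single p k =>
    refine ⟨‖k‖ * (‖p.1‖ * ‖p.2‖), fun G c h => ?_⟩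
    have : R.psiSum (Finsupp.single p k) = k • (R.t p.1 * star (R.t p.2)) := by simp [psiSum]
    rw [this, Unitization.inr_smul, mul_smul_comm, norm_smul, Unitization.inr_mul, ← mul_assoc, h,
      mul_assoc]
    gcongr
    refine (norm_mul_le _ _).trans ?_
    rw [Unitization.norm_inr, Unitization.norm_inr, norm_star]
    calc ‖R.t (G p.1)‖ * ‖R.t p.2‖ ≤ (‖G‖ * ‖p.1‖) * ‖p.2‖ := by
          gcongr
          · exact (R.norm_t_le _).trans (G.le_opNorm _)
          · exact R.norm_t_le _
      _ = ‖p.1‖ * ‖p.2‖ * ‖G‖ := by ring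

/-- This yields both the well-definedness and the continuity of `ψ_t`. With `S = psiSum z`, `T =
finiteRank X z` and `P = S S⋆`, the powers of `P` act on `t(x)` as those of `T T⋆` act on `x`. So
the crude bound applied to high powers of `P`, followed by taking roots, gives the sharp one. -/
theorem norm_psiSum_le (z : X × X →₀ ℂ) : ‖R.psiSum z‖ ≤ ‖finiteRank X z‖ := by
  rcases eq_or_ne (R.psiSum z) 0 with h0 | h0
  · rw [h0, norm_zero]
    exact norm_nonneg _
  obtain ⟨w, hw, hadj⟩ := R.exists_adjoint z
  obtain ⟨K, hK⟩ := R.exists_norm_comp_le z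
  set S := R.psiSum z
  set T := finiteRank X z
  set T' := finiteRank X w
  have hS : 0 < ‖S‖ := norm_pos_iff.2 h0
  let P : Unitization ℂ C := (S : Unitization ℂ C) * star (S : Unitization ℂ C)
  have hP : IsSelfAdjoint P := IsSelfAdjoint.mul_star_self _
  have hPn : ‖P‖ = ‖S‖ ^ 2 := by
    rw [CStarRing.norm_self_mul_star, Unitization.norm_inr, sq]
  have hPt : ∀ x, P * (R.t x : Unitization ℂ C) = (R.t ((T * T') x) : C) := fun x => by
    rw [mul_assoc, ← Unitization.inr_star, ← hw, ← Unitization.inr_mul, R.psiSum_mul_t,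
      ← Unitization.inr_mul, R.psiSum_mul_t]
    rfl
  have hPk : ∀ (k : ℕ) x, P ^ k * (R.t x : Unitization ℂ C) = (R.t (((T * T') ^ k) x) : C) := by
    intro k
    induction k with
    | zero => intro x; simp
    | succ k ih => intro x; rw [pow_succ, mul_assoc, hPt, ih, pow_succ]; rfl
  have hTT : ‖T * T'‖ ≤ ‖T‖ ^ 2 := by
    rw [sq]
    exact (norm_mul_le _ _).trans (by gcongr; exact norm_adjoint_le hadj)
  refine abs_le_of_sq_le_sq' (le_of_pow_two_pow_le (K := |K| / ‖S‖) (by positivity) (by positivity)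
    fun m => ?_) (norm_nonneg _) |>.2
  have hN : 2 ^ m = (2 ^ m - 1) + 1 := (Nat.sub_add_cancel Nat.one_le_two_pow).symm
  set n := 2 ^ m - 1
  -- With `N = 2 ^ m = n + 1`, split `P ^ (2N) = (P ^ N S)(S⋆ P ^ n)`. The crude bound applies to
  -- the first factor; the second is estimated trivially and later cancels.
  have h1 : ‖P ^ 2 ^ (m + 1)‖ ≤ (|K| * (‖T‖ ^ 2) ^ 2 ^ m) * (‖S‖ * (‖S‖ ^ 2) ^ n) := by
    have : P ^ 2 ^ (m + 1) = (P ^ 2 ^ m * (S : Unitization ℂ C)) *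
        (star (S : Unitization ℂ C) * P ^ n) := by
      calc P ^ 2 ^ (m + 1) = P ^ 2 ^ m * P ^ 2 ^ m := by rw [pow_succ 2 m, mul_two, pow_add]
        _ = P ^ 2 ^ m * (P * P ^ n) := by rw [← pow_succ', ← hN]
        _ = _ := by simp only [P, mul_assoc]
    rw [this]
    refine (norm_mul_le _ _).trans (mul_le_mul ?_ ?_ (norm_nonneg _) (by positivity))
    · refine (hK _ _ (hPk _)).trans ?_
      refine mul_le_mul (le_abs_self K) ?_ (norm_nonneg _) (abs_nonneg K)
      refine (norm_pow_le' _ (by positivity)).trans ?_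
      gcongr
    · refine (norm_mul_le _ _).trans ?_
      rw [norm_star, Unitization.norm_inr]
      gcongr
      rw [← hPn]
      exact norm_pow_le _ _
  -- For self-adjoint `P` the norm of a power with exponent `2 ^ k` is the power of the norm; this
  -- is why exponents of that form are used.
  rw [hP.norm_pow_two_pow, hPn] at h1
  have h2 : (‖S‖ ^ 2) ^ 2 ^ (m + 1) = (‖S‖ ^ 2) ^ 2 ^ m * (‖S‖ * ‖S‖) * (‖S‖ ^ 2) ^ n := by
    rw [pow_succ 2 m, mul_two, pow_add]
    conv_lhs => enter [2]; rw [hN, pow_succ]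
    ring
  rw [h2] at h1
  have h4 : (‖S‖ ^ 2) ^ 2 ^ m * ‖S‖ ≤ |K| * (‖T‖ ^ 2) ^ 2 ^ m := by
    refine le_of_mul_le_mul_right ?_ (by positivity : 0 < ‖S‖ * (‖S‖ ^ 2) ^ n)
    calc _ = _ := by ring
      _ ≤ _ := h1
  rw [div_mul_eq_mul_div, le_div_iff₀ hS]
  exact h4

/-- `ψ_t` exists. -/
theorem exists_psi : ∃ ψ : compactOps A X →L[ℂ] C,
    ∀ ξ η, ψ ⟨rankOne A ξ η, rankOne_mem_compactOps ξ η⟩ = R.t ξ * star (R.t η) := by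
  have hrange : {T | ∃ ξ η : X, T = rankOne A ξ η} = range fun p : X × X => rankOne A p.1 p.2 := by
    ext T
    constructor
    · rintro ⟨ξ, η, rfl⟩
      exact ⟨(ξ, η), rfl⟩
    · rintro ⟨p, rfl⟩
      exact ⟨p.1, p.2, rfl⟩
  obtain ⟨ψ, hψ⟩ := exists_extension (compactOps A X) (finiteRank X) R.psiSum
    (by rw [compactOps, finiteRank, Finsupp.range_linearCombination, hrange]) R.norm_psiSum_le
  refine ⟨ψ, fun ξ η => ?_⟩
  have h1 : finiteRank X (Finsupp.single (ξ, η) 1) = rankOne A ξ η := by simp [finiteRank]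
  have h2 : R.psiSum (Finsupp.single (ξ, η) 1) = R.t ξ * star (R.t η) := by simp [psiSum]
  rw [← h2, ← hψ _ (h1 ▸ rankOne_mem_compactOps ξ η)]
  congr 2
  exact h1.symm

/-- The map `t` as a continuous linear map. -/
def tCLM : X →L[ℂ] C := R.t.mkContinuous 1 fun x => by rw [one_mul]; exact R.norm_t_le x

theorem psi_mul_t (ψ : compactOps A X →L[ℂ] C)
    (hψ : ∀ ξ η, ψ ⟨rankOne A ξ η, rankOne_mem_compactOps ξ η⟩ = R.t ξ * star (R.t η))
    (T : compactOps A X) (x : X) : ψ T * R.t x = R.t (T.1 x) := by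
  let L : compactOps A X →L[ℂ] C := ((ContinuousLinearMap.mul ℂ C).flip (R.t x)).comp ψ
    - (R.tCLM.comp (ContinuousLinearMap.apply ℂ X x)).comp (compactOps A X).subtypeL
  have hL : L = 0 := clm_eq_zero_of_closure_span _ L (by
    rintro _ ⟨ξ, η, rfl⟩
    change ψ ⟨rankOne A ξ η, rankOne_mem_compactOps ξ η⟩ * R.t x - R.t (rankOne A ξ η x) = 0
    rw [hψ, mul_assoc, R.star_t_mul_t, R.t_mul_π, rankOne_apply, sub_self])
  exact sub_eq_zero.1 (congrArg (fun L => L T) hL)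

end ToeplitzRep

end Psi

/-! ### The Fock representation -/

section Fock

variable {A : Type u} [NonUnitalCStarAlgebra A] [PartialOrder A] [StarOrderedRing A]

/-- The representations on the tensor powers `X ⊗ ⋯ ⊗ X ⊗ H`. -/
structure Tower (X : Corr A A) : Type (u + 1) where
  Θ : ℕ → HilbRep A
  t : ∀ n, X →ₗ[ℂ] ((Θ n).H →L[ℂ] (Θ (n + 1)).H)
  isTensor : ∀ n, IsTensor X (Θ n) (t n ·)
  act : ∀ n a x h, (Θ (n + 1)).π a (t n x h) = t n (X.φ a x) h

/-- Faithfulness is needed at all levels at once: it makes every level isometric on `A`, hence gives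
lower bounds at arbitrarily high levels. -/
theorem exists_tower {X : Corr A A} (hX : X.IsInjective) :
    ∃ τ : Tower X, ∀ n, Function.Injective (τ.Θ n).π := by
  obtain ⟨Θ₀, h₀⟩ := exists_faithful A
  choose Θ' t' h1 h2 using HilbRep.exists_induced X
  let τ : Tower X :=
    { Θ := fun n => Nat.rec Θ₀ (fun _ Θ => Θ' Θ) n
      t := fun n => t' _
      isTensor := fun n => h1 _
      act := fun n => h2 _ }
  refine ⟨τ, fun n => ?_⟩
  induction n with
  | zero => exact h₀
  | succ n ih => exact (τ.isTensor n).injective hX (τ.act n) ih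

/-! ### The shift on a Hilbert sum -/

section Shift

variable {K : ℕ → Type u} [∀ n, NormedAddCommGroup (K n)]

/-- The sequence `0, f 0, f 1, …`. -/
def shiftFun (f : ∀ n, K (n + 1)) : ∀ n, K n
  | 0 => 0
  | n + 1 => f n

theorem memℓp_shiftFun (f : lp (fun n => K (n + 1)) 2) : Memℓp (shiftFun f) 2 := by
  have h2 : (0 : ℝ) < (2 : ℝ≥0∞).toReal := by norm_num
  exact memℓp_gen ((summable_nat_add_iff 1).1 ((memℓp_gen_iff h2).1 f.2))

variable [∀ n, InnerProductSpace ℂ (K n)]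

/-- The shift `f ↦ (0, f 0, f 1, …)`. -/
def shift : lp (fun n => K (n + 1)) 2 →ₗᵢ[ℂ] lp K 2 where
  toFun f := ⟨shiftFun f, memℓp_shiftFun f⟩
  map_add' f g := lp.ext <| funext fun n => by
    cases n with
    | zero => exact (add_zero (0 : K 0)).symm
    | succ n => rfl
  map_smul' c f := lp.ext <| funext fun n => by
    cases n with
    | zero => exact (smul_zero (A := K 0) c).symm
    | succ n => rfl
  norm_map' f := by
    have h2 : (0 : ℝ) < (2 : ℝ≥0∞).toReal := by norm_num
    refine Real.rpow_left_injOn h2.ne' (norm_nonneg _) (norm_nonneg _) ?_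
    change ‖_‖ ^ (2 : ℝ≥0∞).toReal = ‖_‖ ^ (2 : ℝ≥0∞).toReal
    rw [lp.norm_rpow_eq_tsum h2, lp.norm_rpow_eq_tsum h2]
    change ∑' n, ‖shiftFun f n‖ ^ (2 : ℝ≥0∞).toReal = _
    rw [((memℓp_gen_iff h2).1 (memℓp_shiftFun f)).tsum_eq_zero_add]
    change ‖(0 : K 0)‖ ^ _ + ∑' n, ‖f n‖ ^ _ = _
    rw [norm_zero, Real.zero_rpow h2.ne', zero_add]

end Shift

namespace Tower

variable {X : Corr A A} (τ : Tower X)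

theorem norm_t_le (n : ℕ) (x : X) : ‖τ.t n x‖ ≤ ‖x‖ := by
  refine ContinuousLinearMap.opNorm_le_bound _ (norm_nonneg _) fun h => ?_
  refine abs_le_of_sq_le_sq' ?_ (by positivity) |>.2
  have h1 := (τ.isTensor n).inner_eq x x h h
  rw [mul_pow, norm_sq_eq_re_inner (𝕜 := ℂ) (τ.t n x h), h1, norm_sq_eq_rinner (B := A) x]
  refine (Complex.re_le_norm _).trans ((norm_inner_le_norm _ _).trans ?_)
  calc ‖h‖ * ‖(τ.Θ n).π (rinner A x x) h‖ ≤ ‖h‖ * (‖rinner A x x‖ * ‖h‖) := by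
        gcongr
        refine (ContinuousLinearMap.le_opNorm _ _).trans ?_
        gcongr
        exact NonUnitalStarAlgHom.norm_apply_le _ _
    _ = _ := by ring

/-- The Fock space. -/
abbrev Fock : Type u := lp (fun n => (τ.Θ n).H) 2

/-- The creation operators. -/
def creation : X →ₗ[ℂ] (τ.Fock →L[ℂ] τ.Fock) where
  toFun x := shift.toContinuousLinearMap ∘L
    lp.mapCLM 2 (F := fun n => (τ.Θ (n + 1)).H) (fun n => τ.t n x) (norm_nonneg x)
      fun n => τ.norm_t_le n x
  map_add' x y := ContinuousLinearMap.ext fun f => lp.ext <| funext fun n => by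
    cases n with
    | zero => exact (add_zero (0 : (τ.Θ 0).H)).symm
    | succ n => exact congrArg (fun T => T (f n)) (map_add (τ.t n) x y)
  map_smul' c x := ContinuousLinearMap.ext fun f => lp.ext <| funext fun n => by
    cases n with
    | zero => exact (smul_zero (A := (τ.Θ 0).H) c).symm
    | succ n => exact congrArg (fun T => T (f n)) (map_smul (τ.t n) c x)

theorem creation_zero (x : X) (f : τ.Fock) : τ.creation x f 0 = 0 := rfl

theorem creation_succ (x : X) (f : τ.Fock) (n : ℕ) : τ.creation x f (n + 1) = τ.t n x (f n) := rfl

/-- The Fock representation. -/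
def fockRep : ToeplitzRep X (τ.Fock →L[ℂ] τ.Fock) where
  π := diagHom τ.Θ
  t := τ.creation
  π_mul_t a x := ContinuousLinearMap.ext fun f => lp.ext <| funext fun n => by
    cases n with
    | zero => exact map_zero ((τ.Θ 0).π a)
    | succ n => exact τ.act n a x (f n)
  star_t_mul_t x y := ContinuousLinearMap.ext fun f => ext_inner_left ℂ fun g => by
    rw [mul_apply_eq_comp, ContinuousLinearMap.star_eq_adjoint,
      ContinuousLinearMap.adjoint_inner_right]
    change inner ℂ (shift _) (shift _) = _
    rw [LinearIsometry.inner_map_map, lp.inner_eq_tsum, lp.inner_eq_tsum]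
    exact tsum_congr fun n => (τ.isTensor n).inner_eq x y (g n) (f n)

theorem creation_single (x : X) (n : ℕ) (h : (τ.Θ n).H) :
    τ.creation x (lp.single 2 n h) = lp.single 2 (n + 1) (τ.t n x h) := by
  refine lp.ext <| funext fun m => ?_
  cases m with
  | zero =>
    rw [creation_zero, lp.single_apply_ne _ _ _ (by omega)]
  | succ m =>
    rw [creation_succ]
    rcases eq_or_ne m n with rfl | hm
    · rw [lp.single_apply_self, lp.single_apply_self]
    · rw [lp.single_apply_ne _ _ _ hm, lp.single_apply_ne _ _ _ (by omega), map_zero]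

/-- Creation sends level `n` to level `n + 1`, so its adjoint reads coordinate `n` off coordinate `n
+ 1`. -/
theorem star_creation_apply (x : X) (f : τ.Fock) (n : ℕ) :
    star (τ.creation x) f n = ContinuousLinearMap.adjoint (τ.t n x) (f (n + 1)) := by
  refine ext_inner_left ℂ fun (k : (τ.Θ n).H) => ?_
  have h1 := lp.inner_single_left (𝕜 := ℂ) n k (star (τ.creation x) f)
  have h2 := lp.inner_single_left (𝕜 := ℂ) (n + 1) (τ.t n x k) f
  rw [← creation_single, ← ContinuousLinearMap.adjoint_inner_right] at h2
  exact (h1.symm.trans h2).trans (ContinuousLinearMap.adjoint_inner_right _ _ _).symm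

/-- An operator that kills the image of the creation operators factors through level `0`. -/
theorem apply_eq_of_mul_creation (Q : τ.Fock →L[ℂ] τ.Fock) (hQ : ∀ x, Q * τ.creation x = 0)
    (v : τ.Fock) : Q v = Q (lp.single 2 0 (v 0)) := by
  -- Every positive level is densely spanned by vectors produced by creation operators.
  have h1 : ∀ n (h : (τ.Θ (n + 1)).H), Q (lp.single 2 (n + 1) h) = 0 := fun n h => by
    have : Q ∘L lp.singleContinuousLinearMap ℂ (fun n => (τ.Θ n).H) 2 (n + 1) = 0 :=
      (τ.isTensor n).clm_ext fun x k => by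
        change Q (lp.single 2 (n + 1) (τ.t n x k)) = 0
        rw [← creation_single, ← mul_apply_eq_comp, hQ, zero_apply]
    exact congrArg (fun T => T h) this
  have h2 := (lp.hasSum_single (p := 2) (by norm_num) v).mapL Q
  refine h2.unique (hasSum_single 0 fun n hn => ?_)
  obtain ⟨n, rfl⟩ := Nat.exists_eq_succ_of_ne_zero hn
  exact h1 n _

end Tower

end Fock

/-! ### Operators on the Fock space and escaping sequences -/

section Escape

variable {K : ℕ → Type u} [∀ n, NormedAddCommGroup (K n)] [∀ n, InnerProductSpace ℂ (K n)]

/-- A bounded sequence in `⨁ K n` whose coordinates tend to `0`. -/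
def IsEscaping (h : ℕ → lp K 2) : Prop :=
  (∃ C, ∀ n, ‖h n‖ ≤ C) ∧ ∀ m, Tendsto (fun n => ‖h n m‖) atTop (𝓝 0)

/-- The operator `T` preserves the escaping sequences. -/
def PreservesEscaping (T : lp K 2 →L[ℂ] lp K 2) : Prop :=
  ∀ h, IsEscaping h → ∀ m, Tendsto (fun n => ‖T (h n) m‖) atTop (𝓝 0)

theorem PreservesEscaping.isEscaping {T : lp K 2 →L[ℂ] lp K 2} (hT : PreservesEscaping T)
    {h : ℕ → lp K 2} (hh : IsEscaping h) : IsEscaping fun n => T (h n) := by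
  obtain ⟨C, hC⟩ := hh.1
  exact ⟨⟨‖T‖ * C, fun n => (T.le_opNorm _).trans (by gcongr; exact hC n)⟩, hT h hh⟩

theorem PreservesEscaping.add {S T : lp K 2 →L[ℂ] lp K 2} (hS : PreservesEscaping S)
    (hT : PreservesEscaping T) : PreservesEscaping (S + T) := fun h hh m =>
  squeeze_zero (fun n => norm_nonneg _) (fun n => norm_add_le (S (h n) m) (T (h n) m))
    (by simpa using (hS h hh m).add (hT h hh m))

theorem PreservesEscaping.smul (c : ℂ) {T : lp K 2 →L[ℂ] lp K 2} (hT : PreservesEscaping T) :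
    PreservesEscaping (c • T) := fun h hh m => by
  have h1 : Tendsto (fun n => ‖c‖ * ‖T (h n) m‖) atTop (𝓝 0) := by
    simpa using (hT h hh m).const_mul ‖c‖
  exact h1.congr fun n => (norm_smul c (T (h n) m)).symm

theorem PreservesEscaping.mul {S T : lp K 2 →L[ℂ] lp K 2} (hS : PreservesEscaping S)
    (hT : PreservesEscaping T) : PreservesEscaping (S * T) := fun _ hh =>
  hS _ (hT.isEscaping hh)

theorem preservesEscaping_zero : PreservesEscaping (0 : lp K 2 →L[ℂ] lp K 2) := fun _ _ m =>
  squeeze_zero (fun _ => norm_nonneg _) (fun _ => (norm_zero (E := K m)).le) tendsto_const_nhds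

theorem preservesEscaping_one : PreservesEscaping (1 : lp K 2 →L[ℂ] lp K 2) := fun _ hh => hh.2

theorem PreservesEscaping.of_forall_dist {T : lp K 2 →L[ℂ] lp K 2}
    (H : ∀ ε > 0, ∃ S, PreservesEscaping S ∧ ‖T - S‖ < ε) : PreservesEscaping T := by
  intro h hh m
  obtain ⟨C, hC⟩ := hh.1
  have hC0 : 0 ≤ C := (norm_nonneg _).trans (hC 0)
  rw [Metric.tendsto_nhds]
  intro ε hε
  -- Using `C + 1` keeps the denominator positive when `C = 0`.
  obtain ⟨S, hS, hTS⟩ := H (ε / (2 * (C + 1))) (by positivity)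
  filter_upwards [Metric.tendsto_nhds.1 (hS h hh m) (ε / 2) (half_pos hε)] with n hn
  rw [dist_zero_right, norm_norm] at hn ⊢
  have h1 : ‖T (h n) m - S (h n) m‖ ≤ ‖(T - S) (h n)‖ :=
    lp.norm_apply_le_norm (by simp) ((T - S) (h n)) m
  have h2 : ‖(T - S) (h n)‖ ≤ ε / 2 := calc
    ‖(T - S) (h n)‖ ≤ ‖T - S‖ * ‖h n‖ := ContinuousLinearMap.le_opNorm _ _
    _ ≤ ε / (2 * (C + 1)) * (C + 1) := by
        gcongr
        exact (hC n).trans (by linarith)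
    _ = ε / 2 := by field_simp
  have h3 : ‖T (h n) m‖ ≤ ‖T (h n) m - S (h n) m‖ + ‖S (h n) m‖ := by
    simpa using norm_add_le (T (h n) m - S (h n) m) (S (h n) m)
  linarith

/-- For each `T` the values lie in a compact disc and so converge along a free ultrafilter;
uniqueness of limits makes the limit linear in `T`. -/
theorem exists_limit_functional (h : ℕ → lp K 2) (hh : ∀ n, ‖h n‖ ≤ 1) :
    ∃ F : (lp K 2 →L[ℂ] lp K 2) →ₗ[ℂ] ℂ, ∀ T,
      Tendsto (fun n => inner ℂ (h n) (T (h n))) (hyperfilter ℕ : Filter ℕ) (𝓝 (F T)) := by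
  have h1 : ∀ T : lp K 2 →L[ℂ] lp K 2, ∃ l : ℂ,
      Tendsto (fun n => inner ℂ (h n) (T (h n))) (hyperfilter ℕ : Filter ℕ) (𝓝 l) := fun T => by
    have h2 : ∀ n, inner ℂ (h n) (T (h n)) ∈ Metric.closedBall (0 : ℂ) ‖T‖ := fun n => by
      rw [mem_closedBall_zero_iff]
      calc _ ≤ ‖h n‖ * ‖T (h n)‖ := norm_inner_le_norm _ _
        _ ≤ 1 * (‖T‖ * 1) := by
            gcongr
            · exact hh n
            · exact (T.le_opNorm _).trans (by gcongr; exact hh n)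
        _ = ‖T‖ := by ring
    obtain ⟨l, -, hl⟩ := (isCompact_closedBall (0 : ℂ) ‖T‖).ultrafilter_le_nhds
      ((hyperfilter ℕ).map fun n => inner ℂ (h n) (T (h n)))
      (le_principal_iff.2 (Filter.mem_map.2 (univ_mem' h2)))
    exact ⟨l, hl⟩
  choose F hF using h1
  refine ⟨{ toFun := F, map_add' := fun S T => ?_, map_smul' := fun c T => ?_ }, hF⟩
  · refine tendsto_nhds_unique (hF _) (((hF S).add (hF T)).congr fun n => ?_)
    rw [add_apply, inner_add_right]
  · refine tendsto_nhds_unique (hF _) (((hF T).const_mul c).congr fun n => ?_)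
    rw [smul_apply, inner_smul_right]

variable [∀ n, CompleteSpace (K n)]

variable (K) in
/-- The C⋆-algebra of all operators that, with their adjoints, preserve the escaping sequences. -/
def escapeSubalgebra : NonUnitalStarSubalgebra ℂ (lp K 2 →L[ℂ] lp K 2) where
  carrier := {T | PreservesEscaping T ∧ PreservesEscaping (star T)}
  add_mem' {S T} hS hT := ⟨hS.1.add hT.1, by rw [star_add]; exact hS.2.add hT.2⟩
  zero_mem' := ⟨preservesEscaping_zero, by rw [star_zero]; exact preservesEscaping_zero⟩
  mul_mem' {S T} hS hT := ⟨hS.1.mul hT.1, by rw [star_mul]; exact hT.2.mul hS.2⟩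
  smul_mem' c T hT := ⟨hT.1.smul c, by rw [star_smul]; exact hT.2.smul _⟩
  star_mem' {T} hT := ⟨hT.2, by rw [star_star]; exact hT.1⟩

instance isClosed_escapeSubalgebra :
    IsClosed (escapeSubalgebra K : Set (lp K 2 →L[ℂ] lp K 2)) := by
  refine isClosed_of_closure_subset fun T hT => ?_
  have h1 : ∀ ε > 0, ∃ S ∈ escapeSubalgebra K, ‖T - S‖ < ε := fun ε hε => by
    obtain ⟨S, hS, h⟩ := Metric.mem_closure_iff.1 hT ε hε
    exact ⟨S, hS, by rwa [← dist_eq_norm]⟩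
  refine ⟨.of_forall_dist fun ε hε => ?_, .of_forall_dist fun ε hε => ?_⟩
  · obtain ⟨S, hS, h⟩ := h1 ε hε
    exact ⟨S, hS.1, h⟩
  · obtain ⟨S, hS, h⟩ := h1 ε hε
    exact ⟨star S, hS.2, by rwa [← star_sub, norm_star]⟩

variable (K) in
/-- The C⋆-algebra of all operators that, with their adjoints, preserve the escaping sequences. -/
abbrev EscapeAlgebra : Type u := escapeSubalgebra K

instance : PartialOrder (EscapeAlgebra K) := CStarAlgebra.spectralOrder _

instance : StarOrderedRing (EscapeAlgebra K) := CStarAlgebra.spectralOrderedRing _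

end Escape

/-! ### Faithful covariant representations of injective correspondences -/

section Covariant

variable {A : Type u} [NonUnitalCStarAlgebra A] [PartialOrder A] [StarOrderedRing A]
  {X : Corr A A}

/-- The composition of a representation with a `*`-homomorphism. -/
def ToeplitzRep.map {C C' : Type u} [NonUnitalCStarAlgebra C] [NonUnitalCStarAlgebra C']
    (R : ToeplitzRep X C) (ρ : C →⋆ₙₐ[ℂ] C') : ToeplitzRep X C' where
  π := ρ.comp R.π
  t := (ρ : C →ₗ[ℂ] C').comp R.t
  π_mul_t a ξ := (map_mul ρ _ _).symm.trans (congrArg ρ (R.π_mul_t a ξ))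
  star_t_mul_t ξ η := by
    refine Eq.trans ?_ (congrArg ρ (R.star_t_mul_t ξ η))
    rw [map_mul, map_star]
    rfl

/-- A representation becomes covariant after a `*`-homomorphism that kills `ψ_t(φ(a)) - π(a)`. -/
theorem ToeplitzRep.isCovariant_map {C C' : Type u} [NonUnitalCStarAlgebra C]
    [NonUnitalCStarAlgebra C'] (R : ToeplitzRep X C) (ρ : C →⋆ₙₐ[ℂ] C')
    (h : ∀ q : C, (∀ x, q * R.t x = 0) → ρ q = 0) : (R.map ρ).IsCovariant := by
  obtain ⟨ψ, hψ⟩ := R.exists_psi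
  let ρ' : C →L[ℂ] C' := LinearMap.mkContinuous (ρ : C →ₗ[ℂ] C') 1 fun c => by
    rw [one_mul]
    exact NonUnitalStarAlgHom.norm_apply_le ρ c
  refine ⟨ρ'.comp ψ, fun ξ η => ?_, fun a ha => ?_⟩
  · change ρ (ψ _) = ρ (R.t ξ) * star (ρ (R.t η))
    rw [hψ, map_mul, map_star]
  · change ρ (ψ ⟨X.φ a, _⟩) = ρ (R.π a)
    rw [← sub_eq_zero, ← map_sub]
    -- Both `ψ_t(φ(a))` and `π(a)` carry `t(x)` to `t(φ(a)x)`, so their difference kills the image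
    -- of `t`.
    refine h _ fun x => ?_
    rw [sub_mul, R.psi_mul_t ψ hψ, R.π_mul_t, sub_self]

namespace Tower

variable (τ : Tower X)

theorem π_mem_escapeSubalgebra (a : A) :
    τ.fockRep.π a ∈ escapeSubalgebra fun n => (τ.Θ n).H := by
  have h1 : ∀ a : A, PreservesEscaping (τ.fockRep.π a) := fun a h hh m => by
    refine squeeze_zero (fun n => norm_nonneg _)
      (fun n => ((τ.Θ m).π a).le_opNorm (h n m)) ?_
    simpa using (hh.2 m).const_mul ‖(τ.Θ m).π a‖
  refine ⟨h1 a, ?_⟩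
  rw [← map_star]
  exact h1 _

/-- A creation operator and its adjoint move coordinates by one level only, through bounded maps, so
coordinatewise convergence to zero persists. -/
theorem t_mem_escapeSubalgebra (x : X) :
    τ.fockRep.t x ∈ escapeSubalgebra fun n => (τ.Θ n).H := by
  constructor
  · intro h hh m
    cases m with
    | zero =>
      exact squeeze_zero (fun n => norm_nonneg _) (fun n => (norm_zero (E := (τ.Θ 0).H)).le)
        tendsto_const_nhds
    | succ m =>
      refine squeeze_zero (fun n => norm_nonneg _)
        (fun n => (τ.t m x).le_opNorm (h n m)) ?_
      simpa using (hh.2 m).const_mul ‖τ.t m x‖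
  · intro h hh m
    refine squeeze_zero (fun n => norm_nonneg _) (fun n => ?_)
      (by simpa using (hh.2 (m + 1)).const_mul ‖ContinuousLinearMap.adjoint (τ.t m x)‖)
    change ‖star (τ.creation x) (h n) m‖ ≤ _
    rw [star_creation_apply]
    simpa using (ContinuousLinearMap.adjoint (τ.t m x)).le_opNorm (h n (m + 1))

/-- The Fock representation in the algebra of operators that preserve the escaping sequences. -/
def escapeRep : ToeplitzRep X (EscapeAlgebra fun n => (τ.Θ n).H) where
  π := NonUnitalStarAlgHom.codRestrict τ.fockRep.π _ τ.π_mem_escapeSubalgebra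
  t :=
    { toFun := fun x => ⟨τ.fockRep.t x, τ.t_mem_escapeSubalgebra x⟩
      map_add' := fun x y => Subtype.ext (map_add τ.fockRep.t x y)
      map_smul' := fun c x => Subtype.ext (map_smul τ.fockRep.t c x) }
  π_mul_t a x := Subtype.ext (τ.fockRep.π_mul_t a x)
  star_t_mul_t x y := Subtype.ext (τ.fockRep.star_t_mul_t x y)

end Tower

/-- The points of the algebra are separated from `0` by covariant representations. -/
theorem exists_covariant_ne_zero (hX : X.IsInjective) {c : A} (hc : c ≠ 0) :
    ∃ (C : Type u) (_ : NonUnitalCStarAlgebra C) (R : ToeplitzRep X C),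
      R.IsCovariant ∧ R.π c ≠ 0 := by
  obtain ⟨τ, hτ⟩ := exists_tower hX
  have hc' : 0 < ‖c‖ := norm_pos_iff.2 hc
  -- Level `n` is faithful, hence isometric. Any positive constant below `‖c‖` would do, as long as
  -- it is independent of `n`.
  have hv : ∀ n, ∃ v : (τ.Θ n).H, ‖v‖ < 1 ∧ ‖c‖ / 2 < ‖(τ.Θ n).π c v‖ := fun n =>
    ContinuousLinearMap.exists_lt_apply_of_lt_opNorm _ (by
      rw [NonUnitalStarAlgHom.norm_map _ (hτ n)]
      exact half_lt_self hc')
  choose v hv1 hv2 using hv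
  let h : ℕ → τ.Fock := fun n => lp.single 2 n (v n)
  have hnorm : ∀ n, ‖h n‖ ≤ 1 := fun n => by
    rw [lp.norm_single (by norm_num)]
    exact (hv1 n).le
  have hesc : IsEscaping h := by
    refine ⟨⟨1, hnorm⟩, fun m => ?_⟩
    refine tendsto_const_nhds.congr' (eventually_atTop.2 ⟨m + 1, fun n hn => ?_⟩)
    have h1 : h n m = 0 :=
      lp.single_apply_ne (E := fun n => (τ.Θ n).H) 2 n (v n) (by omega : m ≠ n)
    exact (norm_eq_zero.2 h1).symm
  obtain ⟨F, hF⟩ := exists_limit_functional h hnorm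
  have hF' : ∀ T : τ.Fock →L[ℂ] τ.Fock, Tendsto (fun n => ((‖T (h n)‖ ^ 2 : ℝ) : ℂ))
      (hyperfilter ℕ : Filter ℕ) (𝓝 (F (star T * T))) := fun T =>
    (hF (star T * T)).congr fun n => by
      rw [mul_apply_eq_comp, ContinuousLinearMap.star_eq_adjoint,
        ContinuousLinearMap.adjoint_inner_right, inner_self_eq_norm_sq_to_K]
      norm_num
  have hle : (hyperfilter ℕ : Filter ℕ) ≤ atTop := by
    rw [← Nat.cofinite_eq_atTop]
    exact hyperfilter_le_cofinite
  -- The functional is restricted to `D` because the GNS kernel tests `q b` for every `b` in the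
  -- algebra, and `b (h n)` has to escape as well.
  let D := EscapeAlgebra fun n => (τ.Θ n).H
  let f : D →ₚ[ℂ] ℂ := PositiveLinearMap.mk₀ (F.comp (escapeSubalgebra _).toSubmodule.subtype)
    fun d hd => by
      obtain ⟨e, rfl⟩ := exists_eq_star_mul_self hd
      refine ge_of_tendsto (hF' e.1) (Eventually.of_forall fun n => ?_)
      exact_mod_cast sq_nonneg ‖e.1 (h n)‖
  have hf : ∀ e : D, f (star e * e) = F (star e.1 * e.1) := fun e => rfl
  refine ⟨f.GNS →L[ℂ] f.GNS, inferInstance, τ.escapeRep.map f.gnsNonUnitalStarAlgHom, ?_, ?_⟩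
  · refine τ.escapeRep.isCovariant_map _ fun q hq => (gns_eq_zero_iff f q).2 fun b => ?_
    rw [hf]
    refine tendsto_nhds_unique (hF' _) (Tendsto.mono_left ?_ hle)
    -- The defect `q` sees only coordinate `0`, and that coordinate of `b (h n)` tends to zero.
    have hq' : ∀ w, q.1 w = q.1 (lp.single 2 0 (w 0)) :=
      τ.apply_eq_of_mul_creation q.1 fun x => congrArg Subtype.val (hq x)
    have h1 : Tendsto (fun n => ‖(q * b).1 (h n)‖) atTop (𝓝 0) := by
      refine squeeze_zero (fun n => norm_nonneg _) (fun n => ?_)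
        (by simpa using (b.2.1 h hesc 0).const_mul ‖q.1‖)
      change ‖q.1 (b.1 (h n))‖ ≤ _
      rw [hq']
      refine (q.1.le_opNorm _).trans (le_of_eq (congrArg _ ?_))
      exact lp.norm_single (p := 2) (E := fun n => (τ.Θ n).H) (by norm_num) 0 _
    have h2 := (Complex.continuous_ofReal.tendsto _).comp (h1.pow 2)
    simpa [Function.comp_def] using h2
  · intro h0
    -- Testing against the identity, which lies in `D`, would make `‖π(c) h n‖²` tend to zero,
    -- against the lower bound `(‖c‖ / 2)²`.
    have h1 := (gns_eq_zero_iff f (τ.escapeRep.π c)).1 h0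
      ⟨1, preservesEscaping_one, by rw [star_one]; exact preservesEscaping_one⟩
    rw [hf] at h1
    have h2 := hF' (τ.fockRep.π c * 1)
    have h3 : F (star (τ.fockRep.π c * 1) * (τ.fockRep.π c * 1)) = 0 := h1
    rw [h3] at h2
    have h4 := ge_of_tendsto ((Complex.continuous_re.tendsto _).comp h2)
      (Eventually.of_forall fun n => (?_ : (‖c‖ / 2) ^ 2 ≤ _))
    · rw [Complex.zero_re] at h4
      exact absurd h4 (not_le.2 (by positivity))
    · change _ ≤ ‖(τ.fockRep.π c * 1) (h n)‖ ^ 2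
      refine pow_le_pow_left₀ (by positivity) ?_ 2
      refine (hv2 n).le.trans ?_
      have h5 := lp.norm_apply_le_norm (p := 2) (by simp) ((τ.fockRep.π c * 1) (h n)) n
      refine le_trans (le_of_eq ?_) h5
      exact congrArg (fun w => ‖(τ.Θ n).π c w‖)
        (lp.single_apply_self (E := fun n => (τ.Θ n).H) 2 n (v n)).symm

end Covariant

/-! ### Correspondences with an added tail -/

section GraphSum

variable {V ι : Type u} {A : V → Type u} [∀ p, NonUnitalCStarAlgebra (A p)]
  [∀ p, PartialOrder (A p)] [∀ p, StarOrderedRing (A p)] {ρ σ : ι → V}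
  (Y : ∀ i, Corr (A (ρ i)) (A (σ i)))

theorem GraphSum.term_eq_zero_right {u v : ∀ i, Y i} {i : ι} (h : v i = 0) :
    GraphSum.term Y u v i = 0 := by
  rw [GraphSum.term, h, rinner_zero_right]
  exact map_zero (C0Sum.singleHom A (σ i))

theorem GraphSum.term_eq_zero_left {u v : ∀ i, Y i} {i : ι} (h : u i = 0) :
    GraphSum.term Y u v i = 0 := by
  rw [← GraphSum.star_term, GraphSum.term_eq_zero_right Y h, star_zero]

end GraphSum

section AddTail

variable {V E : Type u} {A : V → Type u} [∀ p, NonUnitalCStarAlgebra (A p)]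
  [∀ p, PartialOrder (A p)] [∀ p, StarOrderedRing (A p)] {G : DirectedGraph V E} {p₀ : V}
  (X : Corr (A p₀) (A p₀)) (Y : ∀ e, Corr (A (G.r e)) (A (G.s e)))

/-- The projection `u ↦ u_none` of `X_τ` onto `X`. -/
def tailProj : addTail X Y →L[ℂ] X :=
  LinearMap.mkContinuous
    { toFun := fun u => (u : GraphSum.Carrier (tailFamily X Y)).1 none
      map_add' := fun _ _ => rfl
      map_smul' := fun _ _ => rfl }
    1 fun u => by
      rw [one_mul]
      exact GraphSum.norm_apply_le (tailFamily X Y) u none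

theorem norm_incl (ξ : X) : ‖incl X Y ξ‖ = ‖ξ‖ := by
  refine (pow_left_inj₀ (norm_nonneg _) (norm_nonneg _) two_ne_zero).1 ?_
  rw [norm_sq_eq_rinner (B := C0Sum A), rinner_incl, C0Sum.norm_single,
    ← norm_sq_eq_rinner (B := A p₀)]

/-- The inclusion of `X` in `X_τ` as a continuous linear map. -/
def inclCLM : X →L[ℂ] addTail X Y :=
  (incl X Y).mkContinuous 1 fun ξ => by rw [one_mul, norm_incl]

theorem rinner_incl_right (u : addTail X Y) (ξ : X) :
    rinner (C0Sum A) u (incl X Y ξ) = C0Sum.single p₀ (rinner (A p₀) (tailProj X Y u) ξ) := by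
  refine tsum_eq_single (f := GraphSum.term (tailFamily X Y)
    (u : GraphSum.Carrier (tailFamily X Y)).1 (inclFun X Y ξ)) none fun i hi =>
      GraphSum.term_eq_zero_right _ ?_
  cases i with
  | none => exact absurd rfl hi
  | some e => rfl

variable {X Y}

/-- Projection and inclusion are adjoint with respect to the inner products at `p₀`, so a compressed
rank-one operator stays rank one. -/
theorem comp_rankOne_comp (u v : addTail X Y) :
    (tailProj X Y).comp ((rankOne (C0Sum A) u v).comp (inclCLM X Y)) =
      rankOne (A p₀) (tailProj X Y u) (tailProj X Y v) := by
  refine ContinuousLinearMap.ext fun ξ => ?_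
  change tailProj X Y (MulOpposite.op (rinner (C0Sum A) v (incl X Y ξ)) • u) =
    MulOpposite.op (rinner (A p₀) (tailProj X Y v) ξ) • tailProj X Y u
  rw [rinner_incl_right]
  change MulOpposite.op ((C0Sum.single p₀ (rinner (A p₀) (tailProj X Y v) ξ)).coord p₀) •
    tailProj X Y u = _
  rw [C0Sum.single_self]

theorem comp_mem_compactOps {T : addTail X Y →L[ℂ] addTail X Y}
    (hT : T ∈ compactOps (C0Sum A) (addTail X Y)) :
    (tailProj X Y).comp (T.comp (inclCLM X Y)) ∈ compactOps (A p₀) X := by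
  let L : (addTail X Y →L[ℂ] addTail X Y) →L[ℂ] (X →L[ℂ] X) :=
    (ContinuousLinearMap.compL ℂ X (addTail X Y) X (tailProj X Y)).comp
      ((ContinuousLinearMap.compL ℂ X (addTail X Y) (addTail X Y)).flip (inclCLM X Y))
  have h1 : (Submodule.span ℂ {T | ∃ ξ η : addTail X Y, T = rankOne (C0Sum A) ξ η}) ≤
      ((Submodule.span ℂ {T | ∃ ξ η : X, T = rankOne (A p₀) ξ η})).comap
        (L : (addTail X Y →L[ℂ] addTail X Y) →ₗ[ℂ] (X →L[ℂ] X)) := by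
    refine Submodule.span_le.2 ?_
    rintro _ ⟨ξ, η, rfl⟩
    exact Submodule.subset_span ⟨_, _, comp_rankOne_comp ξ η⟩
  exact map_mem_closure (f := L) L.continuous hT fun S hS => h1 hS

theorem preK_of_single_mem_preK {a : A p₀} (ha : C0Sum.single p₀ a ∈ (addTail X Y).preK) :
    a ∈ X.preK := by
  have h1 : (tailProj X Y).comp (((addTail X Y).φ (C0Sum.single p₀ a)).comp (inclCLM X Y)) =
      X.φ a := ContinuousLinearMap.ext fun ξ => by
    change tailProj X Y ((addTail X Y).φ (C0Sum.single p₀ a) (incl X Y ξ)) = X.φ a ξ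
    rw [φ_incl]
    rfl
  have h2 := comp_mem_compactOps ha
  rw [h1] at h2
  exact h2

variable (X Y)

open Classical in
/-- The family with the component `y ∈ Y e` and no other. -/
def edgeFun (e : E) (y : Y e) : ∀ i, tailFamily X Y i := Pi.single (some e) y

theorem edgeFun_self (e : E) (y : Y e) : edgeFun X Y e y (some e) = y := by
  classical exact Pi.single_eq_same _ _

theorem edgeFun_of_ne (e : E) (y : Y e) {i : Option E} (h : i ≠ some e) : edgeFun X Y e y i = 0 := by
  classical exact Pi.single_eq_of_ne h _

/-- The element of `X_τ` with the component `y ∈ Y e` and no other. -/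
def edgeIncl (e : E) (y : Y e) : addTail X Y :=
  (⟨edgeFun X Y e y, summable_of_ne_finset_zero (s := {some e}) fun _ hi =>
    GraphSum.term_eq_zero_right _ (edgeFun_of_ne X Y e y fun h => hi (Finset.mem_singleton.2 h))⟩ :
      GraphSum.squareSummable (tailFamily X Y))

/-- The two families have disjoint supports. This orthogonality drives the first inclusion. -/
theorem rinner_incl_edgeIncl (ξ : X) (e : E) (y : Y e) :
    rinner (C0Sum A) (incl X Y ξ) (edgeIncl X Y e y) = 0 := by
  refine Eq.trans (tsum_congr fun i => ?_) tsum_zero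
  cases i with
  | none => exact GraphSum.term_eq_zero_right _ (edgeFun_of_ne X Y e y (Option.some_ne_none e).symm :)
  | some f => exact GraphSum.term_eq_zero_left _ rfl

variable {X Y}

theorem φ_edgeIncl_ne_zero {e : E} {X : Corr (A (G.r e)) (A (G.r e))} {a : A (G.r e)} {y : Y e}
    (h : (Y e).φ a y ≠ 0) :
    (addTail X Y).φ (C0Sum.single (G.r e) a) (edgeIncl X Y e y) ≠ 0 := by
  intro h0
  have h1 : (Y e).φ ((C0Sum.single (G.r e) a).coord (G.r e)) (edgeFun X Y e y (some e) : Y e) = 0 :=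
    congrArg (fun u : addTail X Y => (u : GraphSum.Carrier (tailFamily X Y)).1 (some e)) h0
  rw [C0Sum.single_self] at h1
  exact h ((congrArg _ (edgeFun_self X Y e y).symm).trans h1)

/-- The components of `X_τ` on which `A p₀` acts are `X` and the edges that end at `p₀`. -/
theorem φ_single_eq_zero {e : E} {X : Corr (A (G.r e)) (A (G.r e))}
    (he : ∀ f, G.r f = G.r e → f = e)
    {a : A (G.r e)} (h : X.φ a = 0) (h' : (Y e).φ a = 0) :
    (addTail X Y).φ (C0Sum.single (G.r e) a) = 0 := by
  refine ContinuousLinearMap.ext fun u => GraphSum.carrier_ext fun i => ?_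
  cases i with
  | none =>
    change X.φ ((C0Sum.single (G.r e) a).coord (G.r e)) _ = 0
    rw [C0Sum.single_self, h]
    rfl
  | some f =>
    change (Y f).φ ((C0Sum.single (G.r e) a).coord (G.r f)) _ = 0
    by_cases hf : G.r f = G.r e
    · obtain rfl := he f hf
      rw [C0Sum.single_self, h']
      rfl
    · rw [C0Sum.single_ne _ hf, map_zero]
      rfl

/-- In a covariant representation, `π(J_X)` kills whatever is killed by all `t(ξ)⋆`. -/
theorem ToeplitzRep.IsCovariant.π_mul_eq_zero {B C : Type u} [NonUnitalCStarAlgebra B]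
    [PartialOrder B] [StarOrderedRing B] [NonUnitalCStarAlgebra C] {X : Corr B B}
    {R : ToeplitzRep X C} (hR : R.IsCovariant) {a : B} (ha : a ∈ X.J) {c : C}
    (hc : ∀ ξ, star (R.t ξ) * c = 0) : R.π a * c = 0 := by
  obtain ⟨ψ, hψ, hψ'⟩ := hR
  have h1 : ((ContinuousLinearMap.mul ℂ C).flip c).comp ψ = 0 :=
    clm_eq_zero_of_closure_span _ _ (by
      rintro _ ⟨ξ, η, rfl⟩
      change ψ ⟨rankOne B ξ η, rankOne_mem_compactOps ξ η⟩ * c = 0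
      rw [hψ, mul_assoc, hc, mul_zero])
  rw [← hψ' a ha]
  exact congrArg (fun L => L ⟨X.φ a, ha.2⟩) h1

end AddTail

end CStarTail

end

/-! ### The three inclusions -/

open CStarTail
theorem mainTheorem10 {V E : Type u} (G : DirectedGraph V E) (p₀ : V) (hG : G.IsTailGraph p₀)
    (w : ℕ → E) (hw : G.IsInfinitePath w) (hw₀ : G.r (w 0) = p₀)
    (A : V → Type u) [∀ p, NonUnitalCStarAlgebra (A p)] [∀ p, PartialOrder (A p)]
    [∀ p, StarOrderedRing (A p)]
    (Y : ∀ e, Corr (A (G.r e)) (A (G.s e)))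
    (hfull : ∀ e, (Y e).IsFull)
    (hY : ∀ e, e ≠ w 0 → (Y e).IsInjective ∧
      range (Y e).φ = (compactOps (A (G.s e)) (Y e) : Set (Y e →L[ℂ] Y e)))
    (hY₁ : (compactOps (A (G.s (w 0))) (Y (w 0)) : Set (Y (w 0) →L[ℂ] Y (w 0)))
      ⊆ range (Y (w 0)).φ)
    (X : Corr (A p₀) (A p₀)) (hX : ¬ X.IsInjective)
    (hinj : (addTail X Y).IsInjective)
    (hJ : C0Sum.single p₀ '' ((edgeInto Y (w 0) hw₀).preK + X.J) ⊆ (addTail X Y).J)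
    (hcov : ∀ (C : Type u) [NonUnitalCStarAlgebra C] (R : ToeplitzRep (addTail X Y) C),
      R.IsCovariant → R.restrict.IsCovariant) :
    X.J ⊆ (edgeInto Y (w 0) hw₀).ker ∧
      (edgeInto Y (w 0) hw₀).ker ⊆ perp X.ker ∧
      (edgeInto Y (w 0) hw₀).preK ⊆ X.preK := by
  -- Replacing `p₀` by the range of the first edge makes the transport in `edgeInto` disappear.
  subst hw₀
  refine ⟨fun a ha => ?_, fun a ha b hb => ?_, fun a ha => ?_⟩
  · refine ContinuousLinearMap.ext fun (y : Y (w 0)) => ?_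
    by_contra hy
    have hv := φ_edgeIncl_ne_zero (X := X) hy
    -- The separated element is `⟨v, v⟩`, where `v` is the image of `y` under `a` in `X_τ`.
    obtain ⟨C, _, R, hR, hR0⟩ :=
      exists_covariant_ne_zero hinj fun h => hv (rinner_self_eq_zero (B := C0Sum A).1 h)
    refine hR0 ?_
    have h1 : R.π (C0Sum.single (G.r (w 0)) a) * R.t (edgeIncl X Y (w 0) y) = 0 :=
      (hcov C R hR).π_mul_eq_zero ha fun ξ => by
        change star (R.t (incl X Y ξ)) * _ = 0
        rw [R.star_t_mul_t, rinner_incl_edgeIncl, map_zero]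
    rw [← R.star_t_mul_t, ← R.π_mul_t, h1, mul_zero]
  · have ha' : (Y (w 0)).φ a = 0 := ha
    have hb' : X.φ b = 0 := hb
    have h1 : (addTail X Y).φ (C0Sum.single (G.r (w 0)) (a * b)) = 0 :=
      φ_single_eq_zero (fun f hf => hG.edge_unique hf rfl) (by rw [map_mul, hb', mul_zero])
        (by rw [map_mul, ha', zero_mul])
    have h2 := hinj (h1.trans (map_zero _).symm)
    rw [← C0Sum.single_self (A := A) (G.r (w 0)) (a * b), h2, C0Sum.coord_zero]
  -- Write `a = a + 0` with `0 ∈ J_X` to enter the hypothesis on `J_{X_τ}`; only the compactness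
  -- half of its conclusion is needed.
  · refine preK_of_single_mem_preK
      (hJ ⟨a, ⟨a, ha, 0, ⟨fun b _ => zero_mul b, ?_⟩, add_zero a⟩, rfl⟩).2
    change X.φ 0 ∈ compactOps _ X
    rw [map_zero]
    exact zero_mem _
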